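/- Let $\varepsilon=(\varepsilon(t))_{t\ge 0}$ be a two-state continuous-time Markov chain on $\{0,1\}$ that leaves state $j$ at rate $\lambda_j>0$, let $\mathrm P_i$ be the probability under the initial state $\varepsilon(0)=i$, let $\Gamma(t)=\int_0^t\gamma_{\varepsilon(s)}\,ds$ be the telegraph process with velocities $\gamma_0,\gamma_1$, let $\mathcal T(y)=\min\{t>0:\Gamma(t)=y\}$ ($=\infty$ if $y$ is never reached), and let $F_i(dt)=\mathrm P_i\{\mathcal T(y)\in dt\}$ be the (possibly defective) distribution of $\mathcal T(y)$ on $(0,\infty)$, $i\in\{0,1\}$. Fix $y>0$. Let the parameters vary so that $\lambda_0,\lambda_1\to\infty$, $$\frac{\lambda_0}{\lambda_1}\to\nu^2,\qquad \frac{\gamma_0}{\sqrt{\lambda_0}}\to\sigma_0,\qquad \frac{\gamma_1}{\sqrt{\lambda_1}}\to-\sigma_1,\qquad \frac{\gamma_0\lambda_1+\gamma_1\lambda_0}{\lambda_0+\lambda_1}\to\delta,$$ with $\nu,\sigma_0,\sigma_1>0$ and $\delta\in\mathbb R$. Put $$\Sigma=\frac{\sigma_0\sigma_1}{\sqrt{(\sigma_0^2+\sigma_1^2)/2}},\qquad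 q(t)=\frac{y}{\sqrt{2\pi}\,\Sigma\,t^{3/2}}\exp\left(-\frac{(y-\delta t)^2}{2\Sigma^2t}\right),\quad t>0,$$ so that $q$ is the first-passage density through $y$ of the Brownian motion with drift $\Sigma W(t)+\delta t$. Then, for both $i=0$ and $i=1$, $F_i(dt)$ converges to $q(t)\,dt$: weakly, i.e. $\int g\,dF_i\to\int_0^\infty g(t)q(t)\,dt$ for every bounded continuous $g:\mathbb R\to\mathbb R$ (in particular the total masses $\mathrm P_i\{\mathcal T(y)<\infty\}$ converge), and also in density, i.e. for every $t>0$ the distribution function $s\mapsto F_i((0,s])$ is eventually differentiable at $t$ and its derivative at $t$ converges to $q(t)$. -/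

import Mathlib

open MeasureTheory ProbabilityTheory Filter Topology

noncomputable section

/-- The switching times `τ n = S 0 + ⋯ + S (n - 1)` (so `τ 0 = 0`) built from the successive
holding times `S 0, S 1, …`. -/
def switchingTime {Ω : Type*} (S : ℕ → Ω → ℝ) (n : ℕ) (ω : Ω) : ℝ :=
  ∑ k ∈ Finset.range n, S k ω

/-- Under the probability `P`, the process `ε t ω` (for `t ≥ 0`) is a right-continuous two-state
continuous-time Markov chain on `{0, 1}`, started at `i`, leaving the state `j` at rate `lam j`:
the holding times are independent, the `k`-th of them is spent in the state `i + k` (mod 2) and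
is exponentially distributed with the rate of that state. -/
def IsTwoStateMarkov {Ω : Type*} [MeasurableSpace Ω] (lam : Fin 2 → ℝ) (i : Fin 2)
    (P : Measure Ω) (ε : ℝ → Ω → Fin 2) : Prop :=
  ∃ S : ℕ → Ω → ℝ,
    (∀ k, HasLaw (S k) (expMeasure (lam (Fin.ofNat 2 (i + k)))) P) ∧
    iIndepFun S P ∧
    ∀ᵐ ω ∂P, ∀ k : ℕ, ∀ t : ℝ,
      switchingTime S k ω ≤ t → t < switchingTime S (k + 1) ω → ε t ω = Fin.ofNat 2 (i + k)

/-- The telegraph process `Γ(t) = ∫₀ᵗ γ_{ε(s)} ds`. -/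
def telegraph {Ω : Type*} (γ : Fin 2 → ℝ) (ε : ℝ → Ω → Fin 2) (t : ℝ) (ω : Ω) : ℝ :=
  ∫ s in (0 : ℝ)..t, γ (ε s ω)

/-- The first passage time `min {t > 0 | Γ(t) = y}`, equal to `∞` if `y` is never reached. -/
def firstPassage {Ω : Type*} (γ : Fin 2 → ℝ) (ε : ℝ → Ω → Fin 2) (y : ℝ) (ω : Ω) : ENNReal :=
  ⨅ (t : ℝ) (_ : 0 < t ∧ telegraph γ ε t ω = y), ENNReal.ofReal t

/-- The distribution of the first passage time on the real line, `B ↦ P(T(y) < ∞, T(y) ∈ B)`.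
Its total mass is `P(T(y) < ∞)`, which may be smaller than one. -/
def firstPassageLaw {Ω : Type*} [MeasurableSpace Ω] (γ : Fin 2 → ℝ) (ε : ℝ → Ω → Fin 2)
    (P : Measure Ω) (y : ℝ) : Measure ℝ :=
  ((P.map (firstPassage γ ε y)).restrict {⊤}ᶜ).map ENNReal.toReal

/-- The diffusion coefficient `Σ = σ₀ σ₁ / √((σ₀² + σ₁²) / 2)`. -/
def kacSigma (σ₀ σ₁ : ℝ) : ℝ := σ₀ * σ₁ / √((σ₀ ^ 2 + σ₁ ^ 2) / 2)

/-- The first passage density at time `t > 0`, through the level `y > 0`, of the Brownian motion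
`s * W(t) + δ * t`. -/
def inverseGaussianDensity (s δ y t : ℝ) : ℝ :=
  y / (√(2 * Real.pi) * s * t ^ (3 / 2 : ℝ)) *
    Real.exp (-(y - δ * t) ^ 2 / (2 * s ^ 2 * t))

end

/-! Write `c₀ = γ₀` and `c₁ = -γ₁`, both eventually positive. The path is piecewise linear, so it
first reaches `y` during exactly one stage, or never, and the passage time is an explicit function
of the holding times. A path that is at `y` at time `t` has spent the time `u = (c₁ t + y) / (c₀ +
c₁)` going up and `d = (c₀ t - y) / (c₀ + c₁)` going down, whatever its history. The exponential
holding times therefore always contribute the same factor `exp (-λ₀ u - λ₁ d)`, and only polynomial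
factors distinguish the stages. Integrating out the first holding time gives a recursion that
alternates between the two starting directions; `upDensity` and `downDensity` solve it
(`lintegral_downDensity`, `lintegral_upDensity`).

Summation over the stages gives, for the upward start, an atom of mass `exp (-λ₀ y / c₀)` at `y /
c₀` and the density `λ₀ λ₁ y / (c₀ + c₁) * B (λ₀ λ₁ u d) * exp (-λ₀ u - λ₁ d)`, where `B z = ∑ zⁿ /
(n! (n + 1)!) = I₁(2 √z) / √z`. The downward start has no atom, and its density is the same one
times `passageRatio`.

The limit rests on `B z ~ exp (2 √z) / (2 √π z ^ (3/4))` (`tendsto_rpow_mul_exp_neg_mul_besselSum`).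
The exponents complete a square, `-λ₀ u - λ₁ d + 2 √(λ₀ λ₁ u d) = -(√(λ₀ u) - √(λ₁ d))²`, and `λ₀ u
- λ₁ d = (λ₀ + λ₁) (y - δ t) / (c₀ + c₁)` with `δ` the mean velocity. Dividing by `√(λ₀ u) + √(λ₁
d)` yields the Gaussian exponent, while the power of `z` yields `t ^ (-3/2)` and absorbs the growing
constants. `passageRatio` tends to `1` because `I₂ / I₁` does (`besselMoment_le`,
`le_besselMoment`). A bounded drift forces `σ₀ = ν σ₁`, which identifies `Σ`.

Pointwise convergence of the densities does not control the mass at infinity. Weak convergence,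
total masses included, follows from the uniform integrable bound `D (t + 1) ^ (-3/2)`
(`exists_passageDensity_scaled_le`) and dominated convergence, while the atom loses its mass. -/

/-- The position, after `k` stages, of a path that moves with velocity `v j` during the `j`-th
stage, which lasts for the time `s j`. -/
noncomputable def turningPoint (v s : ℕ → ℝ) (k : ℕ) : ℝ := ∑ j ∈ Finset.range k, v j * s j

/-- The path with velocities `v` and holding times `s` crosses the level `y` during stage `k`. -/
def CrossesAt (v : ℕ → ℝ) (y : ℝ) (k : ℕ) (s : ℕ → ℝ) : Prop :=
  (∀ j ≤ k, turningPoint v s j < y) ∧ y ≤ turningPoint v s (k + 1)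

/-- The time at which the path is at the level `y` during stage `k`. -/
noncomputable def crossingTime (v : ℕ → ℝ) (y : ℝ) (k : ℕ) (s : ℕ → ℝ) : ℝ :=
  ∑ j ∈ Finset.range k, s j + (y - turningPoint v s k) / v k

theorem turningPoint_zero (v s : ℕ → ℝ) : turningPoint v s 0 = 0 := by
  simp [turningPoint]

theorem turningPoint_succ (v s : ℕ → ℝ) (k : ℕ) :
    turningPoint v s (k + 1) = turningPoint v s k + v k * s k := by
  simp [turningPoint, Finset.sum_range_succ]

theorem turningPoint_shift (v s : ℕ → ℝ) (k : ℕ) :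
    turningPoint v s (k + 1)
      = v 0 * s 0 + turningPoint (fun j => v (j + 1)) (fun j => s (j + 1)) k := by
  simp [turningPoint, Finset.sum_range_succ', add_comm]

/-! ### Deterministic paths: the stage and the time of the first crossing -/

section Path

variable {v s : ℕ → ℝ} {e : ℝ → ℝ} {y : ℝ}

theorem intervalIntegrable_stage (k : ℕ) {a b : ℝ} (hab : a ≤ b)
    (ha : ∑ j ∈ Finset.range k, s j ≤ a) (hb : b ≤ ∑ j ∈ Finset.range (k + 1), s j)
    (he : ∀ k t, ∑ j ∈ Finset.range k, s j ≤ t → t < ∑ j ∈ Finset.range (k + 1), s j →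
      e t = v k) :
    IntervalIntegrable e volume a b ∧ ∫ t in a..b, e t = v k * (b - a) := by
  have h : ∀ᵐ t ∂(volume.restrict (Set.uIoc a b)), v k = e t := by
    rw [Set.uIoc_of_le hab, ← Measure.restrict_congr_set Ioo_ae_eq_Ioc]
    filter_upwards [ae_restrict_mem measurableSet_Ioo] with t ht
    exact (he k t (ha.trans ht.1.le) (ht.2.trans_le hb)).symm
  refine ⟨(intervalIntegrable_const (c := v k)).congr_ae h, ?_⟩
  rw [← intervalIntegral.integral_congr_ae_restrict h, intervalIntegral.integral_const, smul_eq_mul,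
    mul_comm]

theorem sum_range_mono (hs : ∀ k, 0 < s k) : StrictMono (fun k => ∑ j ∈ Finset.range k, s j) :=
  strictMono_nat_of_lt_succ fun k => by simp [Finset.sum_range_succ, hs k]

theorem integral_stage (hs : ∀ k, 0 < s k)
    (he : ∀ k t, ∑ j ∈ Finset.range k, s j ≤ t → t < ∑ j ∈ Finset.range (k + 1), s j →
      e t = v k) (k : ℕ) :
    IntervalIntegrable e volume 0 (∑ j ∈ Finset.range k, s j) ∧
    (∫ t in 0..(∑ j ∈ Finset.range k, s j), e t) = turningPoint v s k ∧
    ∀ t, ∑ j ∈ Finset.range k, s j ≤ t → t ≤ ∑ j ∈ Finset.range (k + 1), s j →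
      ∫ r in 0..t, e r = turningPoint v s k + v k * (t - ∑ j ∈ Finset.range k, s j) := by
  have key : ∀ k, IntervalIntegrable e volume 0 (∑ j ∈ Finset.range k, s j) ∧
      (∫ t in 0..(∑ j ∈ Finset.range k, s j), e t) = turningPoint v s k := by
    intro k
    induction k with
    | zero => simp [turningPoint]
    | succ k ih =>
      have hle : ∑ j ∈ Finset.range k, s j ≤ ∑ j ∈ Finset.range (k + 1), s j :=
        (sum_range_mono hs (Nat.lt_succ_self k)).le
      have := intervalIntegrable_stage k hle le_rfl le_rfl he
      refine ⟨ih.1.trans this.1, ?_⟩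
      rw [← intervalIntegral.integral_add_adjacent_intervals ih.1 this.1, ih.2, this.2,
        turningPoint_succ, Finset.sum_range_succ]
      ring
  refine ⟨(key k).1, (key k).2, fun t h1 h2 => ?_⟩
  have := intervalIntegrable_stage k h1 le_rfl h2 he
  rw [← intervalIntegral.integral_add_adjacent_intervals (key k).1 this.1, (key k).2, this.2]

theorem exists_stage (htop : Tendsto (fun k => ∑ j ∈ Finset.range k, s j) atTop atTop)
    {t : ℝ} (ht : 0 ≤ t) :
    ∃ k, ∑ j ∈ Finset.range k, s j ≤ t ∧ t < ∑ j ∈ Finset.range (k + 1), s j := by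
  classical
  have hex : ∃ k, t < ∑ j ∈ Finset.range k, s j := (htop.eventually_gt_atTop t).exists
  obtain ⟨m, hm⟩ : ∃ m, Nat.find hex = m + 1 := by
    refine Nat.exists_eq_succ_of_ne_zero fun h => ?_
    have := Nat.find_spec hex
    rw [h] at this
    simp at this
    linarith
  refine ⟨m, not_lt.1 (Nat.find_min hex (by omega)), ?_⟩
  rw [← hm]; exact Nat.find_spec hex

/-- The path is affine on a stage, so it stays below the larger of its two endpoint values. -/
theorem integral_lt_of_turningPoint_lt (hs : ∀ k, 0 < s k)
    (he : ∀ k t, ∑ j ∈ Finset.range k, s j ≤ t → t < ∑ j ∈ Finset.range (k + 1), s j →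
      e t = v k) {m : ℕ} (h1 : turningPoint v s m < y) (h2 : turningPoint v s (m + 1) < y)
    {t : ℝ} (ht1 : ∑ j ∈ Finset.range m, s j ≤ t) (ht2 : t ≤ ∑ j ∈ Finset.range (m + 1), s j) :
    ∫ r in 0..t, e r < y := by
  rw [(integral_stage hs he m).2.2 t ht1 ht2]
  rw [turningPoint_succ] at h2
  rw [Finset.sum_range_succ] at ht2
  rcases le_total 0 (v m) with h | h
  · nlinarith [mul_le_mul_of_nonneg_left (sub_le_iff_le_add'.2 ht2) h]
  · nlinarith [mul_nonneg_of_nonpos_of_nonpos h (sub_nonpos.2 ht1)]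

/-- The first time at which the path with velocity `e` is at the level `y`. -/
theorem iInf_eq_crossingTime (hs : ∀ k, 0 < s k)
    (htop : Tendsto (fun k => ∑ j ∈ Finset.range k, s j) atTop atTop)
    (he : ∀ k t, ∑ j ∈ Finset.range k, s j ≤ t → t < ∑ j ∈ Finset.range (k + 1), s j →
      e t = v k) {k : ℕ} (hk : CrossesAt v y k s) :
    0 < crossingTime v y k s ∧
    ⨅ (t : ℝ) (_ : 0 < t ∧ ∫ r in 0..t, e r = y), ENNReal.ofReal t
      = ENNReal.ofReal (crossingTime v y k s) := by
  obtain ⟨h1, h2⟩ := hk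
  have hlt := h1 k le_rfl
  have h2' := h2
  rw [turningPoint_succ] at h2'
  have hvk : 0 < v k := by
    have : 0 < v k * s k := by linarith
    exact pos_of_mul_pos_left this (hs k).le
  have hpos : 0 < crossingTime v y k s := by
    unfold crossingTime
    have : 0 < (y - turningPoint v s k) / v k := div_pos (by linarith) hvk
    have h0 : 0 ≤ ∑ j ∈ Finset.range k, s j := Finset.sum_nonneg fun j _ => (hs j).le
    linarith
  have hle1 : ∑ j ∈ Finset.range k, s j ≤ crossingTime v y k s := by
    unfold crossingTime
    have : 0 < (y - turningPoint v s k) / v k := div_pos (by linarith) hvk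
    linarith
  have hle2 : crossingTime v y k s ≤ ∑ j ∈ Finset.range (k + 1), s j := by
    unfold crossingTime
    rw [Finset.sum_range_succ]
    have : (y - turningPoint v s k) / v k ≤ s k := by
      rw [div_le_iff₀ hvk]; linarith
    linarith
  refine ⟨hpos, le_antisymm (iInf₂_le_of_le _ ⟨hpos, ?_⟩ le_rfl) (le_iInf₂ fun t ht => ?_)⟩
  · rw [(integral_stage hs he k).2.2 _ hle1 hle2]
    unfold crossingTime
    field_simp
    ring
  · apply ENNReal.ofReal_le_ofReal
    by_contra! hlt'
    -- An earlier visit to `y` would lie in a stage `m ≤ k`. For `m < k` both ends of the stage are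
    -- below `y`; for `m = k` the affine equation has only one solution.
    obtain ⟨m, hm1, hm2⟩ := exists_stage htop ht.1.le
    have hmk : m ≤ k := by
      by_contra! hc
      have := (sum_range_mono hs).monotone (Nat.succ_le_of_lt hc)
      simp only [Nat.succ_eq_add_one] at this
      linarith
    rcases hmk.lt_or_eq with hmk | rfl
    · exact (integral_lt_of_turningPoint_lt hs he (h1 m hmk.le) (h1 (m + 1) hmk) hm1 hm2.le).ne ht.2
    · have := (integral_stage hs he m).2.2 t hm1 hm2.le
      rw [ht.2] at this
      apply hlt'.ne
      unfold crossingTime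
      rw [this]
      field_simp
      ring

theorem iInf_eq_top_of_not_crossesAt (hs : ∀ k, 0 < s k)
    (htop : Tendsto (fun k => ∑ j ∈ Finset.range k, s j) atTop atTop)
    (he : ∀ k t, ∑ j ∈ Finset.range k, s j ≤ t → t < ∑ j ∈ Finset.range (k + 1), s j →
      e t = v k) (hy : 0 < y) (hk : ∀ k, ¬ CrossesAt v y k s) :
    ⨅ (t : ℝ) (_ : 0 < t ∧ ∫ r in 0..t, e r = y), ENNReal.ofReal t = ⊤ := by
  have hlt : ∀ k, ∀ j ≤ k, turningPoint v s j < y := by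
    intro k
    induction k with
    | zero => intro j hj; obtain rfl : j = 0 := by omega
              rwa [turningPoint_zero]
    | succ k ih =>
      intro j hj
      rcases Nat.le_succ_iff.1 hj with h | rfl
      · exact ih j h
      · by_contra! hc
        exact hk k ⟨ih, hc⟩
  simp only [iInf_eq_top]
  intro t ht
  obtain ⟨m, hm1, hm2⟩ := exists_stage htop ht.1.le
  exact absurd ht.2
    (integral_lt_of_turningPoint_lt hs he (hlt m m le_rfl) (hlt _ (m + 1) le_rfl) hm1 hm2.le).ne

theorem CrossesAt.unique {j k : ℕ} (hj : CrossesAt v y j s) (hk : CrossesAt v y k s) : j = k := by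
  rcases lt_trichotomy j k with h | h | h
  · exact absurd (hk.1 (j + 1) h) (not_lt.2 hj.2)
  · exact h
  · exact absurd (hj.1 (k + 1) h) (not_lt.2 hk.2)

end Path

open scoped ENNReal in
/-- The weight `φ T` of a path that crosses the level `y` during stage `k`, at the time `T`, and
zero for the other paths. -/
noncomputable def stageWeight (v : ℕ → ℝ) (y : ℝ) (φ : ℝ → ℝ≥0∞) (k : ℕ) : (ℕ → ℝ) → ℝ≥0∞ :=
  {s | CrossesAt v y k s}.indicator fun s => φ (crossingTime v y k s)

/-! ### Conditioning on the first holding time -/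

section Recursion

open scoped ENNReal

variable {v : ℕ → ℝ} {y : ℝ} {φ : ℝ → ℝ≥0∞} {k : ℕ}

/-- The path restarts at the first turning point, with `y - v 0 * s 0` left to climb. The condition
at `j = 0` on the left is `0 < y`; if the first stage already reaches `y`, the new level is
nonpositive and the right side fails at its own `j = 0`. -/
theorem crossesAt_succ (s : ℕ → ℝ) (hy : 0 < y) :
    CrossesAt v y (k + 1) s ↔
      CrossesAt (fun j => v (j + 1)) (y - v 0 * s 0) k (fun j => s (j + 1)) := by
  unfold CrossesAt
  rw [turningPoint_shift v s (k + 1), sub_le_iff_le_add']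
  refine and_congr_left fun _ => ⟨fun h j hj => ?_, fun h j hj => ?_⟩
  · have := h (j + 1) (by omega)
    rw [turningPoint_shift] at this
    linarith
  · rcases j with _ | j
    · rwa [turningPoint_zero]
    · rw [turningPoint_shift]
      linarith [h j (by omega)]

theorem crossingTime_succ (s : ℕ → ℝ) :
    crossingTime v y (k + 1) s = s 0 +
      crossingTime (fun j => v (j + 1)) (y - v 0 * s 0) k (fun j => s (j + 1)) := by
  unfold crossingTime
  rw [turningPoint_shift, Finset.sum_range_succ', sub_sub]
  ring

theorem stageWeight_succ (s : ℕ → ℝ) (hy : 0 < y) :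
    stageWeight v y φ (k + 1) s = stageWeight (fun j => v (j + 1)) (y - v 0 * s 0)
      (fun t => φ (s 0 + t)) k (fun j => s (j + 1)) := by
  classical
  unfold stageWeight
  simp only [Set.indicator, Set.mem_ofPred_eq, crossingTime_succ]
  exact if_congr (crossesAt_succ s hy) rfl rfl

theorem measurable_turningPoint (v : ℕ → ℝ) (k : ℕ) :
    Measurable fun s : ℕ → ℝ => turningPoint v s k := by
  unfold turningPoint; fun_prop

theorem measurable_crossingTime (v : ℕ → ℝ) (y : ℝ) (k : ℕ) :
    Measurable fun s : ℕ → ℝ => crossingTime v y k s := by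
  have := measurable_turningPoint v k
  unfold crossingTime; fun_prop

theorem measurableSet_crossesAt (v : ℕ → ℝ) (y : ℝ) (k : ℕ) :
    MeasurableSet {s : ℕ → ℝ | CrossesAt v y k s} := by
  have : {s : ℕ → ℝ | CrossesAt v y k s} = (⋂ j, ⋂ (_ : j ≤ k), {s | turningPoint v s j < y}) ∩
      {s | y ≤ turningPoint v s (k + 1)} := by
    ext s; simp [CrossesAt]
  rw [this]
  refine MeasurableSet.inter (MeasurableSet.iInter fun j => MeasurableSet.iInter fun _ => ?_) ?_
  · exact measurableSet_lt (measurable_turningPoint v j) measurable_const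
  · exact measurableSet_le measurable_const (measurable_turningPoint v (k + 1))

theorem measurable_stageWeight (v : ℕ → ℝ) (y : ℝ) (hφ : Measurable φ) (k : ℕ) :
    Measurable (stageWeight v y φ k) :=
  (hφ.comp (measurable_crossingTime v y k)).indicator (measurableSet_crossesAt v y k)

variable {Ω : Type*} [MeasurableSpace Ω] {P : Measure Ω} {S : ℕ → Ω → ℝ}

theorem indepFun_head_tail (hS : ∀ k, Measurable (S k)) (hind : iIndepFun S P) :
    IndepFun (S 0) (fun ω k => S (k + 1) ω) P := by
  have h := indep_iSup_of_disjoint (fun k => (hS k).comap_le) hind.iIndep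
    (S := {0}) (T := {k | 1 ≤ k}) (by simp)
  refine indep_of_indep_of_le_left (indep_of_indep_of_le_right h ?_) ?_
  · rw [MeasurableSpace.pi, MeasurableSpace.comap_iSup]
    refine iSup_le fun k => ?_
    rw [MeasurableSpace.comap_comp]
    exact le_iSup₂_of_le (k + 1) (by simp) le_rfl
  · simp

theorem measurable_cons : Measurable fun p : ℝ × (ℕ → ℝ) =>
    (fun k => Nat.casesOn k p.1 p.2 : ℕ → ℝ) := by
  refine measurable_pi_lambda _ fun k => ?_
  rcases k with _ | k
  · exact measurable_fst
  · exact (measurable_pi_apply k).comp measurable_snd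

theorem lintegral_stageWeight_succ [IsProbabilityMeasure P] (hS : ∀ k, Measurable (S k))
    (hind : iIndepFun S P) (hφ : Measurable φ) (hy : 0 < y) :
    ∫⁻ ω, stageWeight v y φ (k + 1) (fun j => S j ω) ∂P =
      ∫⁻ a, ∫⁻ ω, stageWeight (fun j => v (j + 1)) (y - v 0 * a) (fun t => φ (a + t)) k
        (fun j => S (j + 1) ω) ∂P ∂(P.map (S 0)) := by
  have hT : Measurable fun ω k => S (k + 1) ω := measurable_pi_lambda _ fun k => hS (k + 1)
  have hF : Measurable fun p : ℝ × (ℕ → ℝ) => stageWeight (fun j => v (j + 1)) (y - v 0 * p.1)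
      (fun t => φ (p.1 + t)) k p.2 := by
    -- Joint measurability in the first holding time and the others comes from gluing them back into
    -- one sequence, where the integrand is a single stage weight.
    convert (measurable_stageWeight v y hφ (k + 1)).comp measurable_cons using 1
    ext p
    simp only [Function.comp]
    rw [stageWeight_succ _ hy]
    rfl
  simp only [stageWeight_succ _ hy]
  have hmap := (indepFun_iff_map_prod_eq_prod_map_map (hS 0).aemeasurable hT.aemeasurable).1
    (indepFun_head_tail hS hind)
  rw [← lintegral_map (f := fun p : ℝ × (ℕ → ℝ) => stageWeight (fun j => v (j + 1)) (y - v 0 * p.1)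
      (fun t => φ (p.1 + t)) k p.2) (g := fun ω => (S 0 ω, fun k => S (k + 1) ω)) hF
      ((hS 0).prodMk hT), hmap, lintegral_prod _ hF.aemeasurable]
  refine lintegral_congr fun a => ?_
  exact lintegral_map (hF.comp (measurable_prodMk_left (x := a))) hT

theorem lintegral_expMeasure (r : ℝ) {f : ℝ → ℝ≥0∞} (hf : Measurable f) :
    ∫⁻ a, f a ∂(expMeasure r) =
      ∫⁻ a in Set.Ioi 0, ENNReal.ofReal (r * Real.exp (-(r * a))) * f a := by
  have hm : Measurable (exponentialPDF r) :=
    (measurable_exponentialPDFReal r).ennreal_ofReal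
  have : expMeasure r = volume.withDensity (exponentialPDF r) := rfl
  rw [this, lintegral_withDensity_eq_lintegral_mul _ hm hf,
    ← lintegral_indicator measurableSet_Ioi]
  refine lintegral_congr_ae ?_
  filter_upwards [compl_mem_ae_iff.2 (measure_singleton (0 : ℝ))] with a ha
  have ha : a ≠ 0 := by simpa using ha
  by_cases h : 0 < a
  · simp [Set.indicator, h, exponentialPDF_of_nonneg h.le]
  · simp [Set.indicator, h, exponentialPDF_of_neg (lt_of_le_of_ne (not_lt.1 h) ha)]

/-- One step of the recursion for the densities of the crossing times. -/
theorem lintegral_stageWeight_succ_of_density [IsProbabilityMeasure P] (hS : ∀ k, Measurable (S k))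
    (hind : iIndepFun S P) {r : ℝ} (hlaw : P.map (S 0) = expMeasure r)
    {g : ℝ → ℝ → ℝ≥0∞} (hg : Measurable (Function.uncurry g))
    (hk : ∀ (z : ℝ) (ψ : ℝ → ℝ≥0∞), Measurable ψ →
      ∫⁻ ω, stageWeight (fun j => v (j + 1)) z ψ k (fun j => S (j + 1) ω) ∂P =
        ∫⁻ t, ψ t * g z t)
    (hφ : Measurable φ) (hy : 0 < y) :
    ∫⁻ ω, stageWeight v y φ (k + 1) (fun j => S j ω) ∂P =
      ∫⁻ t, φ t * ∫⁻ a in Set.Ioi 0, ENNReal.ofReal (r * Real.exp (-(r * a))) *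
        g (y - v 0 * a) (t - a) := by
  have hgm : Measurable fun p : ℝ × ℝ => φ p.1 *
      (ENNReal.ofReal (r * Real.exp (-(r * p.2))) * g (y - v 0 * p.2) (p.1 - p.2)) := by
    refine (hφ.comp measurable_fst).mul (Measurable.mul (by fun_prop) ?_)
    exact hg.comp (f := fun p : ℝ × ℝ => (y - v 0 * p.2, p.1 - p.2)) (by fun_prop)
  -- Translating time by the first holding time moves the shift from the test function to the
  -- density, so that `φ t` can be taken out of the integral over `a`.
  have hswap : ∀ a, ∫⁻ t, φ (a + t) * g (y - v 0 * a) t =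
      ∫⁻ t, φ t * g (y - v 0 * a) (t - a) := fun a => by
    rw [← lintegral_add_left_eq_self (fun t => φ t * g (y - v 0 * a) (t - a)) a]
    simp
  have hmm : Measurable fun a => ∫⁻ t, φ t * g (y - v 0 * a) (t - a) := by
    refine Measurable.lintegral_prod_right' (f := fun p : ℝ × ℝ =>
      φ p.2 * g (y - v 0 * p.1) (p.2 - p.1)) ?_
    refine (hφ.comp measurable_snd).mul ?_
    exact hg.comp (f := fun p : ℝ × ℝ => (y - v 0 * p.1, p.2 - p.1)) (by fun_prop)
  rw [lintegral_stageWeight_succ hS hind hφ hy, hlaw]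
  have h1 : ∀ a, ∫⁻ ω, stageWeight (fun j => v (j + 1)) (y - v 0 * a) (fun t => φ (a + t)) k
      (fun j => S (j + 1) ω) ∂P = ∫⁻ t, φ t * g (y - v 0 * a) (t - a) := fun a => by
    rw [hk _ _ (by fun_prop), hswap]
  simp only [h1]
  rw [lintegral_expMeasure _ hmm]
  have h2 : ∀ a, ENNReal.ofReal (r * Real.exp (-(r * a))) *
      ∫⁻ t, φ t * g (y - v 0 * a) (t - a) = ∫⁻ t, φ t *
        (ENNReal.ofReal (r * Real.exp (-(r * a))) * g (y - v 0 * a) (t - a)) := fun a => by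
    rw [← lintegral_const_mul]
    · exact lintegral_congr fun t => by ring
    · refine hφ.mul ?_
      exact hg.comp (f := fun t : ℝ => (y - v 0 * a, t - a)) (by fun_prop)
  simp only [h2]
  rw [lintegral_lintegral_swap]
  · refine lintegral_congr fun t => ?_
    rw [lintegral_const_mul]
    refine Measurable.mul (by fun_prop) ?_
    exact hg.comp (f := fun a : ℝ => (y - v 0 * a, t - a)) (by fun_prop)
  · exact (hgm.comp measurable_swap).aemeasurable

end Recursion

/-! ### Alternating parameters and independent exponential holding times -/

/-- The sequence `a, b, a, b, …`. -/
def alternating (a b : ℝ) (k : ℕ) : ℝ := if Even k then a else b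

theorem alternating_succ (a b : ℝ) : (fun k => alternating a b (k + 1)) = alternating b a := by
  ext k
  simp only [alternating, Nat.even_add_one]
  split_ifs <;> simp_all

/-- The variables `S k` are independent and exponentially distributed, with the rates `ρ k`. -/
structure IsExpSequence {Ω : Type*} [MeasurableSpace Ω] (ρ : ℕ → ℝ) (S : ℕ → Ω → ℝ)
    (P : Measure Ω) : Prop where
  measurable : ∀ k, Measurable (S k)
  indep : iIndepFun S P
  map_eq : ∀ k, P.map (S k) = expMeasure (ρ k)

theorem IsExpSequence.shift {Ω : Type*} [MeasurableSpace Ω] {ρ : ℕ → ℝ} {S : ℕ → Ω → ℝ}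
    {P : Measure Ω} (h : IsExpSequence ρ S P) :
    IsExpSequence (fun k => ρ (k + 1)) (fun k => S (k + 1)) P where
  measurable k := h.measurable (k + 1)
  indep := h.indep.precomp (g := fun k => k + 1) (add_left_injective 1)
  map_eq k := h.map_eq (k + 1)

theorem lintegral_Ioo_eq_ofReal_sub {F f : ℝ → ℝ} {a b : ℝ} (hab : a ≤ b)
    (hF : ∀ x ∈ Set.Icc a b, HasDerivAt F (f x) x) (hf : ContinuousOn f (Set.Icc a b))
    (hpos : ∀ x ∈ Set.Ioo a b, 0 ≤ f x) :
    ∫⁻ x in Set.Ioo a b, ENNReal.ofReal (f x) = ENNReal.ofReal (F b - F a) := by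
  have hint : IntervalIntegrable f volume a b := by
    refine ContinuousOn.intervalIntegrable ?_
    rwa [Set.uIcc_of_le hab]
  rw [← intervalIntegral.integral_eq_sub_of_hasDerivAt (f := F) (f' := f)
    (by rwa [Set.uIcc_of_le hab]) hint,
    intervalIntegral.integral_of_le hab, integral_Ioc_eq_integral_Ioo,
    ofReal_integral_eq_lintegral_ofReal]
  · exact ((intervalIntegrable_iff_integrableOn_Ioc_of_le hab).1 hint).mono_set
      Set.Ioo_subset_Ioc_self
  · exact (ae_restrict_mem measurableSet_Ioo).mono hpos

/-! ### Explicit densities and their two convolution identities -/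

section Densities

open scoped ENNReal

/-- The time spent moving up with velocity `c₀` by a path that is at the level `y` at the time `t`,
and that moves down with velocity `c₁` otherwise. -/
noncomputable def upTime (c₀ c₁ y t : ℝ) : ℝ := (c₁ * t + y) / (c₀ + c₁)

/-- The time spent moving down with velocity `c₁` by a path that is at the level `y` at the time
`t`, and that moves up with velocity `c₀` otherwise. -/
noncomputable def downTime (c₀ c₁ y t : ℝ) : ℝ := (c₀ * t - y) / (c₀ + c₁)

/-- The density of the first passage times through `y`, after `n + 1` stages of downward motion, of
a path that starts in the upward direction. -/
noncomputable def upDensity (l₀ l₁ c₀ c₁ : ℝ) (n : ℕ) (y t : ℝ) : ℝ :=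
  if 0 < y ∧ y < c₀ * t then
    l₀ * l₁ * y / (c₀ + c₁) *
      ((l₀ * l₁ * upTime c₀ c₁ y t * downTime c₀ c₁ y t) ^ n / (n.factorial * (n + 1).factorial)) *
      Real.exp (-(l₀ * upTime c₀ c₁ y t) - l₁ * downTime c₀ c₁ y t)
  else 0

/-- The density of the first passage times through `y`, after `n + 1` stages of downward motion, of
a path that starts in the downward direction. -/
noncomputable def downDensity (l₀ l₁ c₀ c₁ : ℝ) (n : ℕ) (y t : ℝ) : ℝ :=
  if 0 < y ∧ y < c₀ * t then
    l₁ * c₀ / (c₀ + c₁) *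
      ((l₀ * l₁ * upTime c₀ c₁ y t * downTime c₀ c₁ y t) ^ n / (n.factorial * (n + 1).factorial)) *
      (1 + n * y / (c₀ * upTime c₀ c₁ y t)) *
      Real.exp (-(l₀ * upTime c₀ c₁ y t) - l₁ * downTime c₀ c₁ y t)
  else 0

theorem measurable_upDensity (l₀ l₁ c₀ c₁ : ℝ) (n : ℕ) :
    Measurable (Function.uncurry fun y t => ENNReal.ofReal (upDensity l₀ l₁ c₀ c₁ n y t)) := by
  refine Measurable.ennreal_ofReal (Measurable.ite ?_ ?_ measurable_const)
  · exact (measurableSet_lt measurable_const measurable_fst).inter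
      (measurableSet_lt measurable_fst (by fun_prop))
  · unfold upTime downTime; fun_prop

theorem measurable_downDensity (l₀ l₁ c₀ c₁ : ℝ) (n : ℕ) :
    Measurable (Function.uncurry fun y t => ENNReal.ofReal (downDensity l₀ l₁ c₀ c₁ n y t)) := by
  refine Measurable.ennreal_ofReal (Measurable.ite ?_ ?_ measurable_const)
  · exact (measurableSet_lt measurable_const measurable_fst).inter
      (measurableSet_lt measurable_fst (by fun_prop))
  · unfold upTime downTime; fun_prop

variable {l₀ l₁ c₀ c₁ : ℝ} (hl₀ : 0 < l₀) (hl₁ : 0 < l₁) (hc₀ : 0 < c₀) (hc₁ : 0 < c₁)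

include hl₀ hl₁ hc₀ hc₁

/-- An initial upward stage of length `a` lowers the up time by `a` and leaves the down time
unchanged. The factor `exp (-(l₀ * a))` cancels the change in the exponent, so the integrand is a
polynomial in `a`, the exact derivative of a multiple of `-(u - a) ^ n * (y - c₀ * a)`. -/
theorem lintegral_downDensity (n : ℕ) {y t : ℝ} (hy : 0 < y) :
    ∫⁻ a in Set.Ioi 0, ENNReal.ofReal (l₀ * Real.exp (-(l₀ * a))) *
        ENNReal.ofReal (downDensity l₀ l₁ c₀ c₁ n (y - c₀ * a) (t - a)) =
      ENNReal.ofReal (upDensity l₀ l₁ c₀ c₁ n y t) := by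
  by_cases hyt : y < c₀ * t
  swap
  · have : ∀ a, downDensity l₀ l₁ c₀ c₁ n (y - c₀ * a) (t - a) = 0 := fun a => by
      refine if_neg fun h => hyt ?_
      linarith [h.2]
    simp [this, upDensity, hyt]
  set u := upTime c₀ c₁ y t with hu
  set d := downTime c₀ c₁ y t with hd
  have hcc : 0 < c₀ + c₁ := by positivity
  have hdpos : 0 < d := div_pos (by linarith) hcc
  have hrel : c₀ * u = y + c₁ * d := by
    rw [hu, hd, upTime, downTime]; field_simp; ring
  have hua : ∀ a, upTime c₀ c₁ (y - c₀ * a) (t - a) = u - a := fun a => by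
    rw [hu, upTime, upTime]; field_simp; ring
  have hda : ∀ a, downTime c₀ c₁ (y - c₀ * a) (t - a) = d := fun a => by
    rw [hd, downTime, downTime]; congr 1; ring
  set K : ℝ := l₀ * l₁ / (c₀ + c₁) * ((l₀ * l₁ * d) ^ n / (n.factorial * (n + 1).factorial)) *
    Real.exp (-(l₀ * u) - l₁ * d) with hK
  have hKpos : 0 ≤ K := by positivity
  set F : ℝ → ℝ := fun a => - (K * ((u - a) ^ n * (y - c₀ * a))) with hF
  set f : ℝ → ℝ := fun a => K * (n * (u - a) ^ (n - 1) * (y - c₀ * a) + (u - a) ^ n * c₀) with hf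
  have hderiv : ∀ x, HasDerivAt F (f x) x := fun x => by
    have h1 : HasDerivAt (fun a : ℝ => u - a) (-1) x := by
      simpa using (hasDerivAt_id x).const_sub u
    have h2 : HasDerivAt (fun a : ℝ => y - c₀ * a) (-c₀) x := by
      simpa using ((hasDerivAt_id x).const_mul c₀).const_sub y
    refine HasDerivAt.congr_deriv (((h1.pow n).mul h2).const_mul K).neg ?_
    change -(K * ((n : ℝ) * (u - x) ^ (n - 1) * -1 * (y - c₀ * x) + (u - x) ^ n * -c₀)) =
      K * (n * (u - x) ^ (n - 1) * (y - c₀ * x) + (u - x) ^ n * c₀)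
    ring
  have hyc : 0 ≤ y / c₀ := by positivity
  -- The up time left after the first stage is positive because `c₀ * u = y + c₁ * d` exceeds `c₀ *
  -- a`.
  have hupos : ∀ a < y / c₀, 0 < u - a := fun a ha => by
    rw [lt_div_iff₀ hc₀] at ha
    have : 0 < c₀ * (u - a) := by nlinarith [mul_pos hc₁ hdpos]
    exact pos_of_mul_pos_right this hc₀.le
  have hset : ∀ a ∈ Set.Ioi (0 : ℝ), ENNReal.ofReal (l₀ * Real.exp (-(l₀ * a))) *
        ENNReal.ofReal (downDensity l₀ l₁ c₀ c₁ n (y - c₀ * a) (t - a)) =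
      (Set.Ioo 0 (y / c₀)).indicator (fun a => ENNReal.ofReal (f a)) a := by
    intro a ha
    by_cases hay : a < y / c₀
    · rw [Set.indicator_of_mem (Set.mem_Ioo.2 ⟨ha, hay⟩), ← ENNReal.ofReal_mul (by positivity)]
      congr 1
      have hup := hupos a hay
      rw [lt_div_iff₀ hc₀] at hay
      rw [downDensity, if_pos ⟨by linarith, by linarith⟩, hua, hda, hf, hK]
      have hexp : Real.exp (-(l₀ * (u - a)) - l₁ * d) =
          Real.exp (-(l₀ * u) - l₁ * d) * Real.exp (l₀ * a) := by
        rw [← Real.exp_add]; congr 1; ring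
      have hexp2 : Real.exp (-(l₀ * a)) = (Real.exp (l₀ * a))⁻¹ := Real.exp_neg _
      rw [hexp, hexp2]
      have hne := (Real.exp_pos (l₀ * a)).ne'
      have hf1 : ((n.factorial : ℝ) * (n + 1).factorial) ≠ 0 := by positivity
      -- The exponent `n - 1` is truncated at `n = 0`, where the factor `n` makes that term vanish.
      rcases n with _ | n
      · simp; field_simp
      · simp only [Nat.add_sub_cancel]
        simp only [mul_pow]
        push_cast
        field_simp
        ring
    · rw [Set.indicator_of_notMem (fun h => hay h.2), downDensity, if_neg]
      · simp
      · rintro ⟨h, -⟩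
        apply hay
        rw [lt_div_iff₀ hc₀]; linarith
  rw [setLIntegral_congr_fun measurableSet_Ioi hset, lintegral_indicator measurableSet_Ioo,
    Measure.restrict_restrict measurableSet_Ioo,
    Set.inter_eq_self_of_subset_left Set.Ioo_subset_Ioi_self,
    lintegral_Ioo_eq_ofReal_sub (F := F) hyc (fun x _ => hderiv x) (by fun_prop)]
  · congr 1
    rw [upDensity, if_pos ⟨hy, hyt⟩, ← hu, ← hd, hF, hK]
    simp only
    rw [mul_div_cancel₀ _ hc₀.ne']
    ring
  · intro a ha
    have h1 := hupos a ha.2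
    have h2 : 0 < y - c₀ * a := by
      have := ha.2
      rw [lt_div_iff₀ hc₀] at this; linarith
    simp only [hf]
    positivity

/-- Dually, an initial downward stage of length `a` lowers only the down time. What remains is `(d -
a) ^ n * (y + c₁ * a)`, integrated by parts over `0 < a < d`. -/
theorem lintegral_upDensity (n : ℕ) {y t : ℝ} (hy : 0 < y) :
    ∫⁻ a in Set.Ioi 0, ENNReal.ofReal (l₁ * Real.exp (-(l₁ * a))) *
        ENNReal.ofReal (upDensity l₀ l₁ c₀ c₁ n (y - -c₁ * a) (t - a)) =
      ENNReal.ofReal (downDensity l₀ l₁ c₀ c₁ (n + 1) y t) := by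
  set u := upTime c₀ c₁ y t with hu
  set d := downTime c₀ c₁ y t with hd
  have hcc : 0 < c₀ + c₁ := by positivity
  have hrel : c₀ * u = y + c₁ * d := by
    rw [hu, hd, upTime, downTime]; field_simp; ring
  have hua : ∀ a, upTime c₀ c₁ (y - -c₁ * a) (t - a) = u := fun a => by
    rw [hu, upTime, upTime]; congr 1; ring
  have hda : ∀ a, downTime c₀ c₁ (y - -c₁ * a) (t - a) = d - a := fun a => by
    rw [hd, downTime, downTime]; field_simp; ring
  have hcond : ∀ a, y - -c₁ * a < c₀ * (t - a) ↔ a < d := fun a => by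
    rw [hd, downTime, lt_div_iff₀ hcc]
    constructor <;> intro h <;> linarith
  by_cases hyt : y < c₀ * t
  swap
  · have : ∀ a ∈ Set.Ioi (0 : ℝ), ENNReal.ofReal (l₁ * Real.exp (-(l₁ * a))) *
        ENNReal.ofReal (upDensity l₀ l₁ c₀ c₁ n (y - -c₁ * a) (t - a)) = 0 := fun a ha => by
      rw [upDensity, if_neg]
      · simp
      · rintro ⟨-, h⟩
        have : 0 < c₁ * a := mul_pos hc₁ ha
        have : 0 < c₀ * a := mul_pos hc₀ ha
        exact hyt (by linarith)
    rw [setLIntegral_congr_fun measurableSet_Ioi this]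
    simp [downDensity, hyt]
  have hdpos : 0 < d := div_pos (by linarith) hcc
  have hupos : 0 < u := by
    have : 0 < c₀ * u := by rw [hrel]; positivity
    exact pos_of_mul_pos_right this hc₀.le
  set K : ℝ := l₀ * l₁ * l₁ / (c₀ + c₁) *
    ((l₀ * l₁ * u) ^ n / (n.factorial * (n + 1).factorial)) *
    Real.exp (-(l₀ * u) - l₁ * d) with hK
  have hKpos : 0 ≤ K := by positivity
  set F : ℝ → ℝ := fun a => - (K * ((d - a) ^ (n + 1) * (y + c₁ * a) / (n + 1) +
    c₁ * (d - a) ^ (n + 2) / ((n + 1) * (n + 2)))) with hF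
  set f : ℝ → ℝ := fun a => K * ((d - a) ^ n * (y + c₁ * a)) with hf
  have hderiv : ∀ x, HasDerivAt F (f x) x := fun x => by
    have h1 : HasDerivAt (fun a : ℝ => d - a) (-1) x := by
      simpa using (hasDerivAt_id x).const_sub d
    have h2 : HasDerivAt (fun a : ℝ => y + c₁ * a) c₁ x := by
      simpa using ((hasDerivAt_id x).const_mul c₁).const_add y
    refine HasDerivAt.congr_deriv (((((h1.pow (n + 1)).mul h2).div_const ((n : ℝ) + 1)).add
      (((h1.pow (n + 2)).const_mul c₁).div_const (((n : ℝ) + 1) * (n + 2)))).const_mul K).neg ?_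
    change -(K * ((((n + 1 : ℕ) : ℝ) * (d - x) ^ n * -1 * (y + c₁ * x) + (d - x) ^ (n + 1) * c₁)
      / ((n : ℝ) + 1) + c₁ * (((n + 2 : ℕ) : ℝ) * (d - x) ^ (n + 1) * -1) /
      (((n : ℝ) + 1) * (n + 2)))) = K * ((d - x) ^ n * (y + c₁ * x))
    push_cast
    field_simp
    ring
  have hset : ∀ a ∈ Set.Ioi (0 : ℝ), ENNReal.ofReal (l₁ * Real.exp (-(l₁ * a))) *
        ENNReal.ofReal (upDensity l₀ l₁ c₀ c₁ n (y - -c₁ * a) (t - a)) =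
      (Set.Ioo 0 d).indicator (fun a => ENNReal.ofReal (f a)) a := by
    intro a ha
    have ha0 : (0 : ℝ) < a := ha
    by_cases hay : a < d
    · rw [Set.indicator_of_mem (Set.mem_Ioo.2 ⟨ha, hay⟩), ← ENNReal.ofReal_mul (by positivity)]
      congr 1
      rw [upDensity, if_pos ⟨by nlinarith [mul_pos hc₁ ha0], (hcond a).2 hay⟩, hua, hda, hf, hK]
      have hexp : Real.exp (-(l₀ * u) - l₁ * (d - a)) =
          Real.exp (-(l₀ * u) - l₁ * d) * Real.exp (l₁ * a) := by
        rw [← Real.exp_add]; congr 1; ring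
      have hexp2 : Real.exp (-(l₁ * a)) = (Real.exp (l₁ * a))⁻¹ := Real.exp_neg _
      rw [hexp, hexp2]
      have hne := (Real.exp_pos (l₁ * a)).ne'
      simp only [mul_pow]
      field_simp
      ring
    · rw [Set.indicator_of_notMem (fun h => hay h.2), upDensity, if_neg]
      · simp
      · rintro ⟨-, h⟩
        exact hay ((hcond a).1 h)
  rw [setLIntegral_congr_fun measurableSet_Ioi hset, lintegral_indicator measurableSet_Ioo,
    Measure.restrict_restrict measurableSet_Ioo,
    Set.inter_eq_self_of_subset_left Set.Ioo_subset_Ioi_self,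
    lintegral_Ioo_eq_ofReal_sub (F := F) hdpos.le (fun x _ => hderiv x) (by fun_prop)]
  · congr 1
    -- This relation trades the extra factor `c₁ * d` for `u` and `y`, and thereby produces the
    -- factor `1 + (n + 1) * y / (c₀ * u)` of `downDensity`.
    have hcd : c₁ * d = c₀ * u - y := by linarith
    have hFd : F d = 0 := by simp [hF]
    have hF0 : F 0 = - (K * (d ^ (n + 1) * ((n + 1) * y + c₀ * u) / ((n + 1) * (n + 2)))) := by
      simp only [hF]
      have : c₁ * (d - 0) ^ (n + 2) = d ^ (n + 1) * (c₀ * u - y) := by rw [← hcd]; ring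
      rw [this]
      field_simp
      ring
    have hfac : (n.factorial : ℝ) ≠ 0 := by positivity
    rw [hFd, hF0, downDensity, if_pos ⟨hy, hyt⟩, ← hu, ← hd, hK]
    simp only [Nat.factorial_succ, mul_pow]
    push_cast
    field_simp
    ring
  · intro a ha
    have h1 : 0 < d - a := sub_pos.2 ha.2
    have h2 : 0 < a := ha.1
    simp only [hf]
    positivity

end Densities

/-! ### Positivity and divergence of the switching times -/

section ExpSequence

open scoped ENNReal

theorem expMeasure_Ioi {r x : ℝ} (hr : 0 < r) (hx : 0 ≤ x) :
    expMeasure r (Set.Ioi x) = ENNReal.ofReal (Real.exp (-(r * x))) := by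
  have := isProbabilityMeasure_expMeasure hr
  have h := cdf_expMeasure_eq hr x
  rw [cdf_eq_real, if_pos hx] at h
  rw [← Set.compl_Iic, ← ofReal_measureReal, probReal_compl_eq_one_sub measurableSet_Iic, h]
  congr 1; ring

theorem expMeasure_Ici {r x : ℝ} (hr : 0 < r) (hx : 0 ≤ x) :
    expMeasure r (Set.Ici x) = ENNReal.ofReal (Real.exp (-(r * x))) := by
  have : expMeasure r ≪ volume := withDensity_absolutelyContinuous _ _
  rw [← expMeasure_Ioi hr hx]
  exact (measure_congr (this.ae_eq Ioi_ae_eq_Ici)).symm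

variable {Ω : Type*} [MeasurableSpace Ω] {P : Measure Ω} {S : ℕ → Ω → ℝ} {ρ : ℕ → ℝ}

theorem IsExpSequence.ae_pos (h : IsExpSequence ρ S P) [IsProbabilityMeasure P]
    (hρ : ∀ k, 0 < ρ k) : ∀ᵐ ω ∂P, ∀ k, 0 < S k ω := by
  refine ae_all_iff.2 fun k => ?_
  have := isProbabilityMeasure_expMeasure (hρ k)
  have h1 : ∀ᵐ a ∂(P.map (S k)), 0 < a := by
    rw [h.map_eq]
    refine (mem_ae_iff_prob_eq_one measurableSet_Ioi).2 ?_
    change expMeasure (ρ k) (Set.Ioi 0) = 1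
    rw [expMeasure_Ioi (hρ k) le_rfl]
    simp
  exact ae_of_ae_map (h.measurable k).aemeasurable h1

/-- The rates are bounded, so the independent events `S k > 1` have probabilities bounded below. By
the second Borel–Cantelli lemma infinitely many of them occur, and the holding times cannot be
summable. -/
theorem IsExpSequence.ae_tendsto_atTop (h : IsExpSequence ρ S P) [IsProbabilityMeasure P]
    (hρ : ∀ k, 0 < ρ k) {R : ℝ} (hR : ∀ k, ρ k ≤ R) :
    ∀ᵐ ω ∂P, Tendsto (fun n => ∑ k ∈ Finset.range n, S k ω) atTop atTop := by
  set A : ℕ → Set Ω := fun k => S k ⁻¹' Set.Ioi 1 with hA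
  have hAm : ∀ k, MeasurableSet (A k) := fun k => h.measurable k measurableSet_Ioi
  have hind : iIndepSet A P := by
    rw [iIndepSet_iff_meas_biInter hAm]
    intro s
    exact h.indep.measure_inter_preimage_eq_mul s (sets := fun _ => Set.Ioi 1)
      fun _ _ => measurableSet_Ioi
  have hsum : ∑' n, P (A n) = ∞ := by
    have h1 : ∀ n, ENNReal.ofReal (Real.exp (-R)) ≤ P (A n) := fun n => by
      rw [hA, ← Measure.map_apply (h.measurable n) measurableSet_Ioi, h.map_eq,
        expMeasure_Ioi (hρ n) zero_le_one]
      apply ENNReal.ofReal_le_ofReal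
      rw [Real.exp_le_exp]
      linarith [hR n]
    rw [eq_top_iff, ← ENNReal.tsum_const_eq_top_of_ne_zero (α := ℕ)
      (c := ENNReal.ofReal (Real.exp (-R))) (by simp [Real.exp_pos])]
    exact ENNReal.tsum_le_tsum h1
  have hlim : ∀ᵐ ω ∂P, ω ∈ limsup A atTop :=
    (mem_ae_iff_prob_eq_one (MeasurableSet.measurableSet_limsup hAm)).2
      (measure_limsup_eq_one hAm hind hsum)
  filter_upwards [hlim, h.ae_pos hρ] with ω hω hpos
  rw [← not_summable_iff_tendsto_nat_atTop_of_nonneg fun k => (hpos k).le]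
  intro hs
  rw [mem_limsup_iff_frequently_mem] at hω
  obtain ⟨k, hk1, hk2⟩ :=
    (hω.and_eventually (hs.tendsto_atTop_zero.eventually_lt_const zero_lt_one)).exists
  exact lt_asymm hk1 hk2

end ExpSequence

/-! ### The law of the crossing time, stage by stage -/

section StageLaws

open scoped ENNReal

variable {Ω : Type*} [MeasurableSpace Ω] {P : Measure Ω} [IsProbabilityMeasure P]
  {S : ℕ → Ω → ℝ} {l₀ l₁ c₀ c₁ y : ℝ} {φ : ℝ → ℝ≥0∞}

theorem alternating_pos (hl₀ : 0 < l₀) (hl₁ : 0 < l₁) (k : ℕ) : 0 < alternating l₀ l₁ k := by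
  unfold alternating; split_ifs <;> assumption

theorem alternating_le (hl₀ : 0 < l₀) (hl₁ : 0 < l₁) (k : ℕ) :
    alternating l₀ l₁ k ≤ l₀ + l₁ := by
  unfold alternating; split_ifs <;> linarith

theorem stageWeight_of_nonpos (v : ℕ → ℝ) (hy : y ≤ 0) (k : ℕ) (s : ℕ → ℝ) :
    stageWeight v y φ k s = 0 := by
  refine Set.indicator_of_notMem (fun h => ?_) _
  have := h.1 0 (Nat.zero_le k)
  rw [turningPoint_zero] at this
  linarith

theorem stageWeight_of_velocity_nonpos {v s : ℕ → ℝ} {k : ℕ} (hv : v k ≤ 0) (hs : 0 < s k) :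
    stageWeight v y φ k s = 0 := by
  refine Set.indicator_of_notMem (fun h => ?_) _
  have h1 := h.1 k le_rfl
  have h2 := h.2
  rw [turningPoint_succ] at h2
  nlinarith [mul_nonneg (neg_nonneg.2 hv) hs.le]

theorem lintegral_stageWeight_of_velocity_nonpos {ρ : ℕ → ℝ} (hS : IsExpSequence ρ S P)
    (hρ : ∀ k, 0 < ρ k) {v : ℕ → ℝ} {k : ℕ} (hv : v k ≤ 0) :
    ∫⁻ ω, stageWeight v y φ k (fun j => S j ω) ∂P = 0 := by
  rw [lintegral_eq_zero_of_ae_eq_zero]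
  filter_upwards [hS.ae_pos hρ] with ω hω
  exact stageWeight_of_velocity_nonpos hv (hω k)

-- Crossing without any switch takes the deterministic time `y / v 0`. This is the source of the
-- atom.
omit [IsProbabilityMeasure P] in
theorem lintegral_stageWeight_zero {ρ : ℕ → ℝ} (hS : IsExpSequence ρ S P)
    (hρ : ∀ k, 0 < ρ k) {v : ℕ → ℝ} (hv : 0 < v 0) (hy : 0 < y) :
    ∫⁻ ω, stageWeight v y φ 0 (fun j => S j ω) ∂P =
      ENNReal.ofReal (Real.exp (-(ρ 0 * (y / v 0)))) * φ (y / v 0) := by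
  have h1 : ∀ ω, stageWeight v y φ 0 (fun j => S j ω) =
      (S 0 ⁻¹' Set.Ici (y / v 0)).indicator (fun _ => φ (y / v 0)) ω := fun ω => by
    classical
    simp only [stageWeight, Set.indicator, crossingTime, turningPoint_zero, Finset.range_zero,
      Finset.sum_empty, sub_zero, zero_add]
    refine if_congr ?_ rfl rfl
    simp [CrossesAt, turningPoint, hy, div_le_iff₀ hv, mul_comm]
  simp only [h1]
  rw [lintegral_indicator (hS.measurable 0 measurableSet_Ici), setLIntegral_const,
    ← Measure.map_apply (hS.measurable 0) measurableSet_Ici, hS.map_eq,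
    expMeasure_Ici (hρ 0) (by positivity), mul_comm]

theorem lintegral_downTime (hc₀ : 0 < c₀) (hc₁ : 0 < c₁) (F : ℝ → ℝ≥0∞) :
    ∫⁻ a in Set.Ioi 0, F a = ∫⁻ t in Set.Ioi (y / c₀),
      ENNReal.ofReal (c₀ / (c₀ + c₁)) * F (downTime c₀ c₁ y t) := by
  have hcc : 0 < c₀ + c₁ := by positivity
  have himg : downTime c₀ c₁ y '' Set.Ioi (y / c₀) = Set.Ioi 0 := by
    ext a
    simp only [Set.mem_image, Set.mem_Ioi, downTime]
    constructor
    · rintro ⟨t, ht, rfl⟩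
      rw [div_lt_iff₀ hc₀] at ht
      exact div_pos (by linarith) hcc
    · intro ha
      refine ⟨((c₀ + c₁) * a + y) / c₀, ?_, ?_⟩
      · gcongr
        nlinarith [mul_pos hcc ha]
      · field_simp; ring
  rw [← himg, lintegral_image_eq_lintegral_abs_deriv_mul (f' := fun _ => c₀ / (c₀ + c₁))
    measurableSet_Ioi]
  · rw [abs_of_pos (by positivity)]
  · intro t _
    have : HasDerivAt (downTime c₀ c₁ y) (c₀ * 1 / (c₀ + c₁)) t :=
      (((hasDerivAt_id t).const_mul c₀).sub_const y).div_const (c₀ + c₁)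
    rw [mul_one] at this
    exact this.hasDerivWithinAt
  · intro a _ b _ hab
    simp only [downTime] at hab
    field_simp at hab
    exact mul_left_cancel₀ hc₀.ne' (by linarith)

variable (hl₀ : 0 < l₀) (hl₁ : 0 < l₁) (hc₀ : 0 < c₀) (hc₁ : 0 < c₁)

include hl₀ hl₁ hc₀ hc₁

/-- This base case is separate because the preceding stage has an atom and no density. The passage
time is a function of the single downward holding time `a = downTime c₀ c₁ y t`, and the change of
variables has Jacobian `c₀ / (c₀ + c₁)`. -/
theorem lintegral_stageWeight_one (hS : IsExpSequence (alternating l₁ l₀) S P)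
    (hφ : Measurable φ) :
    ∫⁻ ω, stageWeight (alternating (-c₁) c₀) y φ 1 (fun j => S j ω) ∂P =
      ∫⁻ t, φ t * ENNReal.ofReal (downDensity l₀ l₁ c₀ c₁ 0 y t) := by
  rcases le_or_gt y 0 with hy | hy
  · simp [stageWeight_of_nonpos _ hy, downDensity, hy.not_gt]
  have hcc : 0 < c₀ + c₁ := by positivity
  have hv0 : alternating (-c₁) c₀ 0 = -c₁ := by simp [alternating]
  have hρ0 : alternating l₁ l₀ 0 = l₁ := by simp [alternating]
  have hv1 : alternating c₀ (-c₁) 0 = c₀ := by simp [alternating]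
  have hρ1 : alternating l₀ l₁ 0 = l₀ := by simp [alternating]
  have hS' := hS.shift
  rw [alternating_succ] at hS'
  rw [lintegral_stageWeight_succ hS.measurable hS.indep hφ hy, alternating_succ, hS.map_eq,
    hρ0, hv0]
  have hpos : ∀ a ∈ Set.Ioi (0 : ℝ), 0 < y - -c₁ * a := fun a ha => by
    have : 0 < c₁ * a := mul_pos hc₁ ha
    linarith
  have hinner : ∀ a ∈ Set.Ioi (0 : ℝ), ∫⁻ ω, stageWeight (alternating c₀ (-c₁)) (y - -c₁ * a)
      (fun t => φ (a + t)) 0 (fun j => S (j + 1) ω) ∂P =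
      ENNReal.ofReal (Real.exp (-(l₀ * ((y - -c₁ * a) / c₀)))) *
        φ (a + (y - -c₁ * a) / c₀) := fun a ha => by
    rw [lintegral_stageWeight_zero hS' (alternating_pos hl₀ hl₁) (by rw [hv1]; exact hc₀)
      (hpos a ha), hv1, hρ1]
  have hae : ∀ᵐ a ∂(expMeasure l₁), a ∈ Set.Ioi (0 : ℝ) := by
    have := isProbabilityMeasure_expMeasure hl₁
    refine (mem_ae_iff_prob_eq_one measurableSet_Ioi).2 ?_
    change expMeasure l₁ (Set.Ioi 0) = 1
    rw [expMeasure_Ioi hl₁ le_rfl]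
    simp
  rw [lintegral_congr_ae (hae.mono hinner), lintegral_expMeasure _ (by fun_prop),
    lintegral_downTime (y := y) hc₀ hc₁, ← lintegral_indicator measurableSet_Ioi]
  refine lintegral_congr fun t => ?_
  by_cases ht : y / c₀ < t
  · rw [Set.indicator_of_mem (Set.mem_Ioi.2 ht)]
    rw [div_lt_iff₀ hc₀, mul_comm] at ht
    have hu : (y - -c₁ * downTime c₀ c₁ y t) / c₀ = upTime c₀ c₁ y t := by
      rw [downTime, upTime]; field_simp; ring
    have ht' : downTime c₀ c₁ y t + upTime c₀ c₁ y t = t := by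
      rw [downTime, upTime]; field_simp; ring
    rw [hu, ht', downDensity, if_pos ⟨hy, ht⟩, ← mul_assoc, ← mul_assoc, mul_comm _ (φ t),
      ← ENNReal.ofReal_mul (by positivity), ← ENNReal.ofReal_mul (by positivity)]
    congr 2
    rw [sub_eq_add_neg, Real.exp_add]
    simp
    ring
  · rw [Set.indicator_of_notMem (by simpa using ht), downDensity, if_neg]
    · simp
    · rw [div_lt_iff₀ hc₀, mul_comm] at ht
      exact fun h => ht h.2

theorem lintegral_stageWeight_down (n : ℕ) (hdown : ∀ S : ℕ → Ω → ℝ,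
      IsExpSequence (alternating l₁ l₀) S P → ∀ y (φ : ℝ → ℝ≥0∞), Measurable φ →
      ∫⁻ ω, stageWeight (alternating (-c₁) c₀) y φ (2 * n + 1) (fun j => S j ω) ∂P =
        ∫⁻ t, φ t * ENNReal.ofReal (downDensity l₀ l₁ c₀ c₁ n y t))
    (hS : IsExpSequence (alternating l₀ l₁) S P) (hφ : Measurable φ) :
    ∫⁻ ω, stageWeight (alternating c₀ (-c₁)) y φ (2 * n + 2) (fun j => S j ω) ∂P =
      ∫⁻ t, φ t * ENNReal.ofReal (upDensity l₀ l₁ c₀ c₁ n y t) := by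
  rcases le_or_gt y 0 with hy | hy
  · simp [stageWeight_of_nonpos _ hy, upDensity, hy.not_gt]
  have hS' := hS.shift
  rw [alternating_succ] at hS'
  have hρ : P.map (S 0) = expMeasure l₀ := by simpa [alternating] using hS.map_eq 0
  have hv0 : alternating c₀ (-c₁) 0 = c₀ := by simp [alternating]
  rw [lintegral_stageWeight_succ_of_density hS.measurable hS.indep hρ
    (measurable_downDensity l₀ l₁ c₀ c₁ n) (k := 2 * n + 1) ?_ hφ hy, hv0]
  · simp only [lintegral_downDensity hl₀ hl₁ hc₀ hc₁ n hy]
  · intro z ψ hψ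
    rw [alternating_succ]
    exact hdown _ hS' z ψ hψ

theorem lintegral_stageWeight_up (n : ℕ) (hup : ∀ S : ℕ → Ω → ℝ,
      IsExpSequence (alternating l₀ l₁) S P → ∀ y (φ : ℝ → ℝ≥0∞), Measurable φ →
      ∫⁻ ω, stageWeight (alternating c₀ (-c₁)) y φ (2 * n + 2) (fun j => S j ω) ∂P =
        ∫⁻ t, φ t * ENNReal.ofReal (upDensity l₀ l₁ c₀ c₁ n y t))
    (hS : IsExpSequence (alternating l₁ l₀) S P) (hφ : Measurable φ) :
    ∫⁻ ω, stageWeight (alternating (-c₁) c₀) y φ (2 * n + 3) (fun j => S j ω) ∂P =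
      ∫⁻ t, φ t * ENNReal.ofReal (downDensity l₀ l₁ c₀ c₁ (n + 1) y t) := by
  rcases le_or_gt y 0 with hy | hy
  · simp [stageWeight_of_nonpos _ hy, downDensity, hy.not_gt]
  have hS' := hS.shift
  rw [alternating_succ] at hS'
  have hρ : P.map (S 0) = expMeasure l₁ := by simpa [alternating] using hS.map_eq 0
  have hv0 : alternating (-c₁) c₀ 0 = -c₁ := by simp [alternating]
  rw [lintegral_stageWeight_succ_of_density hS.measurable hS.indep hρ
    (measurable_upDensity l₀ l₁ c₀ c₁ n) (k := 2 * n + 2) ?_ hφ hy, hv0]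
  · simp only [lintegral_upDensity hl₀ hl₁ hc₀ hc₁ n hy]
  · intro z ψ hψ
    rw [alternating_succ]
    exact hup _ hS' z ψ hψ

theorem lintegral_stageWeight_odd (n : ℕ) (hS : IsExpSequence (alternating l₁ l₀) S P)
    (y : ℝ) (hφ : Measurable φ) :
    ∫⁻ ω, stageWeight (alternating (-c₁) c₀) y φ (2 * n + 1) (fun j => S j ω) ∂P =
      ∫⁻ t, φ t * ENNReal.ofReal (downDensity l₀ l₁ c₀ c₁ n y t) := by
  induction n generalizing S y φ with
  | zero => exact lintegral_stageWeight_one hl₀ hl₁ hc₀ hc₁ hS hφ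
  | succ n ih =>
    exact lintegral_stageWeight_up hl₀ hl₁ hc₀ hc₁ n (fun S hS y φ hφ =>
      lintegral_stageWeight_down hl₀ hl₁ hc₀ hc₁ n (fun S hS y φ hφ => ih hS y hφ) hS hφ) hS hφ

theorem lintegral_stageWeight_even (n : ℕ) (hS : IsExpSequence (alternating l₀ l₁) S P)
    (y : ℝ) (hφ : Measurable φ) :
    ∫⁻ ω, stageWeight (alternating c₀ (-c₁)) y φ (2 * n + 2) (fun j => S j ω) ∂P =
      ∫⁻ t, φ t * ENNReal.ofReal (upDensity l₀ l₁ c₀ c₁ n y t) :=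
  lintegral_stageWeight_down hl₀ hl₁ hc₀ hc₁ n
    (fun _ hS y _ hφ => lintegral_stageWeight_odd hl₀ hl₁ hc₀ hc₁ n hS y hφ) hS hφ

theorem tsum_lintegral_stageWeight_up (hS : IsExpSequence (alternating l₀ l₁) S P)
    (hy : 0 < y) (hφ : Measurable φ) :
    ∑' k, ∫⁻ ω, stageWeight (alternating c₀ (-c₁)) y φ k (fun j => S j ω) ∂P =
      ENNReal.ofReal (Real.exp (-(l₀ * (y / c₀)))) * φ (y / c₀) +
        ∫⁻ t, φ t * ∑' n, ENNReal.ofReal (upDensity l₀ l₁ c₀ c₁ n y t) := by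
  have hpos := alternating_pos hl₀ hl₁
  have h0 := lintegral_stageWeight_zero (φ := φ) hS hpos (v := alternating c₀ (-c₁))
    (by simpa [alternating] using hc₀) hy
  rw [show alternating c₀ (-c₁) 0 = c₀ by simp [alternating],
    show alternating l₀ l₁ 0 = l₀ by simp [alternating]] at h0
  have hodd : ∀ n, ∫⁻ ω, stageWeight (alternating c₀ (-c₁)) y φ (2 * n + 1) (fun j => S j ω) ∂P
      = 0 := fun n =>
    lintegral_stageWeight_of_velocity_nonpos hS hpos (by simp [alternating, hc₁.le])
  -- Only upward stages, here the even ones, can cross the level. Stage `0` is split off as the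
  -- atom.
  rw [← tsum_even_add_odd ENNReal.summable ENNReal.summable,
    tsum_eq_zero_add' ENNReal.summable]
  simp only [hodd, tsum_zero, add_zero, mul_zero, mul_add, mul_one, h0,
    lintegral_stageWeight_even hl₀ hl₁ hc₀ hc₁ _ hS y hφ]
  rw [← lintegral_tsum]
  · simp only [ENNReal.tsum_mul_left]
  · intro n
    exact (hφ.mul ((measurable_upDensity l₀ l₁ c₀ c₁ n).comp
      (measurable_prodMk_left (x := y)))).aemeasurable

theorem tsum_lintegral_stageWeight_down (hS : IsExpSequence (alternating l₁ l₀) S P)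
    (hφ : Measurable φ) :
    ∑' k, ∫⁻ ω, stageWeight (alternating (-c₁) c₀) y φ k (fun j => S j ω) ∂P =
      ∫⁻ t, φ t * ∑' n, ENNReal.ofReal (downDensity l₀ l₁ c₀ c₁ n y t) := by
  have hpos := alternating_pos hl₁ hl₀
  have heven : ∀ n, ∫⁻ ω, stageWeight (alternating (-c₁) c₀) y φ (2 * n) (fun j => S j ω) ∂P
      = 0 := fun n =>
    lintegral_stageWeight_of_velocity_nonpos hS hpos (by simp [alternating, hc₁.le])
  rw [← tsum_even_add_odd ENNReal.summable ENNReal.summable]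
  simp only [heven, tsum_zero, zero_add,
    lintegral_stageWeight_odd hl₀ hl₁ hc₀ hc₁ _ hS y hφ]
  rw [← lintegral_tsum]
  · simp only [ENNReal.tsum_mul_left]
  · intro n
    exact (hφ.mul ((measurable_downDensity l₀ l₁ c₀ c₁ n).comp
      (measurable_prodMk_left (x := y)))).aemeasurable

end StageLaws

/-! ### From the first passage time to the sum over stages -/

section Law

open scoped ENNReal

variable {v s : ℕ → ℝ} {y : ℝ}

theorem tsum_stageWeight_of_crossesAt {k : ℕ} (hk : CrossesAt v y k s) (φ : ℝ → ℝ≥0∞) :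
    ∑' k, stageWeight v y φ k s = φ (crossingTime v y k s) := by
  rw [tsum_eq_single (f := fun k => stageWeight v y φ k s) k fun j hj =>
    Set.indicator_of_notMem (s := {s | CrossesAt v y j s}) (fun h => hj (CrossesAt.unique h hk)) _]
  exact Set.indicator_of_mem (s := {s | CrossesAt v y k s}) hk _

theorem tsum_stageWeight_of_not_crossesAt (hk : ∀ k, ¬ CrossesAt v y k s) (φ : ℝ → ℝ≥0∞) :
    ∑' k, stageWeight v y φ k s = 0 := by
  simp [stageWeight, hk]

/-- The law of the first passage time, in terms of the stages at which the level is crossed. -/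
theorem lintegral_firstPassageLaw_eq_tsum {Ω : Type*} [MeasurableSpace Ω] {P : Measure Ω}
    [IsProbabilityMeasure P] {S : ℕ → Ω → ℝ} {ρ : ℕ → ℝ} (hS : IsExpSequence ρ S P)
    (hρ : ∀ k, 0 < ρ k) {R : ℝ} (hR : ∀ k, ρ k ≤ R) {γ : Fin 2 → ℝ} {ε : ℝ → Ω → Fin 2}
    (hε : ∀ᵐ ω ∂P, ∀ k t, ∑ j ∈ Finset.range k, S j ω ≤ t →
      t < ∑ j ∈ Finset.range (k + 1), S j ω → γ (ε t ω) = v k)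
    (hy : 0 < y) {φ : ℝ → ℝ≥0∞} (hφ : Measurable φ) :
    ∫⁻ t, φ t ∂(firstPassageLaw γ ε P y) =
      ∑' k, ∫⁻ ω, stageWeight v y φ k (fun j => S j ω) ∂P := by
  have hSm : Measurable fun ω j => S j ω := measurable_pi_lambda _ hS.measurable
  have hwm : ∀ {ψ : ℝ → ℝ≥0∞} (_ : Measurable ψ) k,
      Measurable fun ω => stageWeight v y ψ k (fun j => S j ω) := fun hψ k =>
    (measurable_stageWeight v y hψ k).comp hSm
  have hfp : ∀ᵐ ω ∂P,
      (∃ k, CrossesAt v y k (fun j => S j ω) ∧ 0 < crossingTime v y k (fun j => S j ω) ∧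
        firstPassage γ ε y ω = ENNReal.ofReal (crossingTime v y k (fun j => S j ω))) ∨
      ((∀ k, ¬ CrossesAt v y k (fun j => S j ω)) ∧ firstPassage γ ε y ω = ⊤) := by
    filter_upwards [hε, hS.ae_pos hρ, hS.ae_tendsto_atTop hρ hR] with ω h1 h2 h3
    by_cases h : ∃ k, CrossesAt v y k (fun j => S j ω)
    · obtain ⟨k, hk⟩ := h
      have := iInf_eq_crossingTime (e := fun t => γ (ε t ω)) h2 h3 h1 hk
      exact Or.inl ⟨k, hk, this.1, this.2⟩
    · push Not at h
      exact Or.inr ⟨h, iInf_eq_top_of_not_crossesAt (e := fun t => γ (ε t ω)) h2 h3 h1 hy h⟩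
  -- The first passage time is an infimum over uncountably many times. Almost surely it agrees with
  -- a countable sum having at most one nonzero term, plus `⊤` on the paths that never cross.
  have haem : AEMeasurable (firstPassage γ ε y) P := by
    refine ⟨fun ω => ∑' k, stageWeight v y ENNReal.ofReal k (fun j => S j ω) +
      ({ω | ∀ k, ¬ CrossesAt v y k (fun j => S j ω)}.indicator (fun _ => ⊤) ω), ?_, ?_⟩
    · refine (Measurable.tsum fun k => hwm ENNReal.measurable_ofReal k).add
        (measurable_const.indicator ?_)
      have : {ω | ∀ k, ¬ CrossesAt v y k (fun j => S j ω)} =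
          ⋂ k, ((fun ω j => S j ω) ⁻¹' {s | CrossesAt v y k s})ᶜ := by
        ext ω; simp
      rw [this]
      exact MeasurableSet.iInter fun k => (hSm (measurableSet_crossesAt v y k)).compl
    · filter_upwards [hfp] with ω hω
      rcases hω with ⟨k, hk, -, h⟩ | ⟨hk, h⟩
      · rw [h, tsum_stageWeight_of_crossesAt hk, Set.indicator_of_notMem, add_zero]
        exact fun h' => h' k hk
      · rw [h, tsum_stageWeight_of_not_crossesAt hk, zero_add]
        exact (Set.indicator_of_mem (s := {ω | ∀ k, ¬ CrossesAt v y k (fun j => S j ω)}) hk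
          (fun _ => (⊤ : ℝ≥0∞))).symm
  have hmeas : Measurable fun x : ℝ≥0∞ => φ x.toReal := hφ.comp ENNReal.measurable_toReal
  have htop : MeasurableSet ({⊤}ᶜ : Set ℝ≥0∞) := (measurableSet_singleton _).compl
  rw [firstPassageLaw, lintegral_map hφ ENNReal.measurable_toReal,
    ← lintegral_indicator htop, lintegral_map' (hmeas.indicator htop).aemeasurable haem,
    ← lintegral_tsum fun k => (hwm hφ k).aemeasurable]
  refine lintegral_congr_ae ?_
  filter_upwards [hfp] with ω hω
  rcases hω with ⟨k, hk, hpos, h⟩ | ⟨hk, h⟩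
  · rw [tsum_stageWeight_of_crossesAt hk, h, Set.indicator_of_mem (by simp),
      ENNReal.toReal_ofReal hpos.le]
  · rw [tsum_stageWeight_of_not_crossesAt hk, h, Set.indicator_of_notMem (by simp)]

theorem apply_ofNat_eq_alternating (f : Fin 2 → ℝ) (i : Fin 2) (k : ℕ) :
    f (Fin.ofNat 2 (i + k)) = alternating (f i) (f (i + 1)) k := by
  unfold alternating
  split_ifs with h
  · congr 1
    ext
    obtain ⟨m, rfl⟩ := h
    simp only [Fin.val_ofNat]
    omega
  · congr 1
    ext
    rw [Nat.not_even_iff_odd] at h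
    obtain ⟨m, rfl⟩ := h
    simp only [Fin.val_ofNat, Fin.val_add, Fin.val_one]
    omega

variable {Ω : Type*} [MeasurableSpace Ω] {P : Measure Ω}
    [IsProbabilityMeasure P] {lam γ : Fin 2 → ℝ} {ε : ℝ → Ω → Fin 2}

-- The given holding times are only almost everywhere measurable; measurable versions replace them,
-- outside a null set common to all indices.
omit [IsProbabilityMeasure P] in
theorem IsTwoStateMarkov.exists_isExpSequence {i : Fin 2} (hε : IsTwoStateMarkov lam i P ε) :
    ∃ S : ℕ → Ω → ℝ, IsExpSequence (alternating (lam i) (lam (i + 1))) S P ∧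
      ∀ γ : Fin 2 → ℝ, ∀ᵐ ω ∂P, ∀ k t, ∑ j ∈ Finset.range k, S j ω ≤ t →
        t < ∑ j ∈ Finset.range (k + 1), S j ω →
        γ (ε t ω) = alternating (γ i) (γ (i + 1)) k := by
  obtain ⟨S, h1, h2, h3⟩ := hε
  have hae : ∀ k, S k =ᵐ[P] (h1 k).aemeasurable.mk (S k) := fun k => (h1 k).aemeasurable.ae_eq_mk
  refine ⟨fun k => (h1 k).aemeasurable.mk (S k),
    ⟨fun k => (h1 k).aemeasurable.measurable_mk, h2.congr hae, fun k => ?_⟩, fun γ => ?_⟩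
  · rw [← Measure.map_congr (hae k), (h1 k).map_eq, apply_ofNat_eq_alternating lam i k]
  · filter_upwards [h3, ae_all_iff.2 hae] with ω hω hS k t ht1 ht2
    rw [← apply_ofNat_eq_alternating γ i k]
    simp only [← hS] at ht1 ht2
    rw [hω k t ht1 ht2]

theorem lintegral_firstPassageLaw_up (hlam : ∀ j, 0 < lam j) (hε : IsTwoStateMarkov lam 0 P ε)
    (hγ₀ : 0 < γ 0) (hγ₁ : γ 1 < 0) (hy : 0 < y) {φ : ℝ → ℝ≥0∞} (hφ : Measurable φ) :
    ∫⁻ t, φ t ∂(firstPassageLaw γ ε P y) =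
      ENNReal.ofReal (Real.exp (-(lam 0 * (y / γ 0)))) * φ (y / γ 0) +
        ∫⁻ t, φ t * ∑' n, ENNReal.ofReal (upDensity (lam 0) (lam 1) (γ 0) (-γ 1) n y t) := by
  obtain ⟨S, hS, hεS⟩ := hε.exists_isExpSequence
  rw [zero_add] at hS
  rw [lintegral_firstPassageLaw_eq_tsum hS (alternating_pos (hlam 0) (hlam 1))
    (alternating_le (hlam 0) (hlam 1)) (hεS γ) hy hφ]
  simpa using tsum_lintegral_stageWeight_up (hlam 0) (hlam 1) hγ₀ (neg_pos.2 hγ₁) hS hy hφ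

theorem lintegral_firstPassageLaw_down (hlam : ∀ j, 0 < lam j)
    (hε : IsTwoStateMarkov lam 1 P ε)
    (hγ₀ : 0 < γ 0) (hγ₁ : γ 1 < 0) (hy : 0 < y) {φ : ℝ → ℝ≥0∞} (hφ : Measurable φ) :
    ∫⁻ t, φ t ∂(firstPassageLaw γ ε P y) =
      ∫⁻ t, φ t * ∑' n, ENNReal.ofReal (downDensity (lam 0) (lam 1) (γ 0) (-γ 1) n y t) := by
  obtain ⟨S, hS, hεS⟩ := hε.exists_isExpSequence
  rw [show (1 : Fin 2) + 1 = 0 from rfl] at hS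
  rw [lintegral_firstPassageLaw_eq_tsum hS (alternating_pos (hlam 1) (hlam 0))
    (alternating_le (hlam 1) (hlam 0)) (hεS γ) hy hφ]
  simpa using tsum_lintegral_stageWeight_down (hlam 0) (hlam 1) hγ₀ (neg_pos.2 hγ₁) hS hφ

end Law

/-! ### The Bessel series and bounds for the ratio of `I₂` to `I₁` -/

section BesselSeries

/-- The `n`-th term of the power series `∑ zⁿ / (n! (n + 1)!)` of the modified Bessel function
`I₁(2 √z) / √z`. -/
noncomputable def besselTerm (z : ℝ) (n : ℕ) : ℝ := z ^ n / (n.factorial * (n + 1).factorial)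

/-- The modified Bessel function `I₁(2 √z) / √z`. -/
noncomputable def besselSum (z : ℝ) : ℝ := ∑' n, besselTerm z n

/-- The modified Bessel function `I₂(2 √z)`, as a power series in `z`. -/
noncomputable def besselMoment (z : ℝ) : ℝ := ∑' n : ℕ, n * besselTerm z n

theorem abs_natCast_mul_besselTerm_le (R : ℝ) {z : ℝ} (hz : |z| ≤ R) (n : ℕ) :
    ‖n * besselTerm z n‖ ≤ R ^ n / n.factorial := by
  rw [besselTerm, Real.norm_eq_abs, abs_mul, abs_div, abs_pow, abs_of_nonneg (by positivity),
    abs_of_nonneg (by positivity : (0 : ℝ) ≤ n.factorial * (n + 1).factorial)]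
  have h1 : |z| ^ n ≤ R ^ n := pow_le_pow_left₀ (abs_nonneg z) hz n
  have h2 : (n : ℝ) ≤ (n + 1).factorial := by
    exact_mod_cast (Nat.le_succ n).trans (Nat.self_le_factorial (n + 1))
  rw [mul_div_assoc', div_le_div_iff₀ (by positivity) (by positivity)]
  have := mul_le_mul h2 h1 (by positivity) (by positivity)
  have h3 : (0 : ℝ) ≤ n.factorial := by positivity
  nlinarith [mul_le_mul_of_nonneg_right this h3]

theorem abs_besselTerm_le (R : ℝ) {z : ℝ} (hz : |z| ≤ R) (n : ℕ) :
    ‖besselTerm z n‖ ≤ R ^ n / n.factorial := by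
  rw [besselTerm, Real.norm_eq_abs, abs_div, abs_pow,
    abs_of_nonneg (by positivity : (0 : ℝ) ≤ n.factorial * (n + 1).factorial)]
  have h1 : |z| ^ n ≤ R ^ n := pow_le_pow_left₀ (abs_nonneg z) hz n
  have h2 : (1 : ℝ) ≤ (n + 1).factorial := by exact_mod_cast Nat.one_le_iff_ne_zero.2 (by positivity)
  have h3 : (0 : ℝ) < n.factorial := by positivity
  have h4 : (n.factorial : ℝ) ≤ n.factorial * (n + 1).factorial := by nlinarith
  gcongr
  exact (pow_nonneg (abs_nonneg z) n).trans h1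

theorem summable_besselTerm (z : ℝ) : Summable (besselTerm z) :=
  Summable.of_norm_bounded (Real.summable_pow_div_factorial |z|) (abs_besselTerm_le _ le_rfl)

theorem summable_natCast_mul_besselTerm (z : ℝ) : Summable fun n : ℕ => n * besselTerm z n :=
  Summable.of_norm_bounded (Real.summable_pow_div_factorial |z|)
    (abs_natCast_mul_besselTerm_le _ le_rfl)

theorem continuous_tsum_of_le_pow_div_factorial {f : ℕ → ℝ → ℝ} (hf : ∀ n, Continuous (f n))
    (hb : ∀ R z, |z| ≤ R → ∀ n, ‖f n z‖ ≤ R ^ n / n.factorial) :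
    Continuous fun z => ∑' n, f n z := by
  rw [continuous_iff_continuousAt]
  intro z
  refine (continuousOn_tsum (s := {w | |w| ≤ |z| + 1}) (fun n => (hf n).continuousOn)
    (Real.summable_pow_div_factorial (|z| + 1)) fun n w hw => hb _ w hw n).continuousAt ?_
  filter_upwards [continuous_abs.continuousAt.eventually_lt_const (lt_add_one |z|)] with w hw
  exact hw.le

theorem continuous_besselSum : Continuous besselSum :=
  continuous_tsum_of_le_pow_div_factorial (f := fun n z => besselTerm z n)
    (fun n => by unfold besselTerm; fun_prop) fun R _ hz => abs_besselTerm_le R hz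

theorem continuous_besselMoment : Continuous besselMoment :=
  continuous_tsum_of_le_pow_div_factorial (f := fun n z => n * besselTerm z n)
    (fun n => by unfold besselTerm; fun_prop) fun R _ hz => abs_natCast_mul_besselTerm_le R hz

theorem besselTerm_nonneg {z : ℝ} (hz : 0 ≤ z) (n : ℕ) : 0 ≤ besselTerm z n := by
  unfold besselTerm; positivity

theorem besselSum_pos {z : ℝ} (hz : 0 ≤ z) : 0 < besselSum z := by
  refine (summable_besselTerm z).tsum_pos (besselTerm_nonneg hz) 0 ?_
  simp [besselTerm]

theorem besselMoment_nonneg {z : ℝ} (hz : 0 ≤ z) : 0 ≤ besselMoment z :=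
  tsum_nonneg fun n => mul_nonneg n.cast_nonneg (besselTerm_nonneg hz n)

theorem hasSum_mul_succ_mul_besselTerm (z : ℝ) :
    HasSum (fun n : ℕ => (n : ℝ) * (n + 1) * besselTerm z n) (z * besselSum z) := by
  rw [← hasSum_nat_add_iff' 1]
  simp only [Finset.range_one, Finset.sum_singleton, Nat.cast_zero, zero_mul, sub_zero]
  refine ((summable_besselTerm z).hasSum.mul_left z).congr_fun fun n => ?_
  simp only [besselTerm, Nat.factorial_succ]
  push_cast
  have : (n.factorial : ℝ) ≠ 0 := by positivity
  field_simp
  ring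

/-- Sum `n ≤ n (n + 1) / (2 √z) + √z / 2`, a form of the AM-GM inequality, against the terms of the
series; the weighted sum of `n (n + 1)` is `z * besselSum z`. -/
theorem besselMoment_le {z : ℝ} (hz : 0 < z) : besselMoment z ≤ √z * besselSum z := by
  have hs := Real.sqrt_pos.2 hz
  have hsq := Real.mul_self_sqrt hz.le
  have h1 : HasSum (fun n : ℕ => ((n : ℝ) * (n + 1) * besselTerm z n) * (1 / (2 * √z)) +
      besselTerm z n * (√z / 2)) (√z * besselSum z) := by
    have e : √z * besselSum z = z * besselSum z * (1 / (2 * √z)) + besselSum z * (√z / 2) := by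
      field_simp
      rw [Real.sq_sqrt hz.le]
      ring
    rw [e]
    exact ((hasSum_mul_succ_mul_besselTerm z).mul_right (1 / (2 * √z))).add
      ((summable_besselTerm z).hasSum.mul_right (√z / 2))
  refine hasSum_le (fun n => ?_) (summable_natCast_mul_besselTerm z).hasSum h1
  have : (n : ℝ) ≤ n * (n + 1) * (1 / (2 * √z)) + √z / 2 := by
    rw [mul_one_div, div_add_div _ _ (by positivity) (by positivity), le_div_iff₀ (by positivity)]
    nlinarith [sq_nonneg ((n : ℝ) - √z), (n.cast_nonneg : (0 : ℝ) ≤ n)]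
  nlinarith [mul_le_mul_of_nonneg_right this (besselTerm_nonneg hz.le n)]

theorem le_besselMoment {z : ℝ} (hz : 0 < z) :
    (√z - 1) * besselSum z ≤ besselMoment z := by
  have hs := Real.sqrt_pos.2 hz
  have hsq := Real.mul_self_sqrt hz.le
  -- the series `v n = (n + 1) w n` satisfies `∑ n v n = z ∑ w n` and `∑ n² v n = z ∑ v n`
  have hv : HasSum (fun n : ℕ => ((n : ℝ) + 1) * besselTerm z n)
      (besselMoment z + besselSum z) := by
    refine ((summable_natCast_mul_besselTerm z).hasSum.add
      (summable_besselTerm z).hasSum).congr_fun fun n => ?_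
    ring
  have hv2 : HasSum (fun n : ℕ => (n : ℝ) ^ 2 * ((n + 1) * besselTerm z n))
      (z * (besselMoment z + besselSum z)) := by
    rw [← hasSum_nat_add_iff' 1]
    simp only [Finset.range_one, Finset.sum_singleton, Nat.cast_zero, zero_mul, sub_zero,
      ne_eq, OfNat.ofNat_ne_zero, not_false_eq_true, zero_pow]
    refine (hv.mul_left z).congr_fun fun n => ?_
    simp only [besselTerm, Nat.factorial_succ]
    push_cast
    have : (n.factorial : ℝ) ≠ 0 := by positivity
    field_simp
    ring
  have h1 : HasSum (fun n : ℕ => ((n : ℝ) ^ 2 * ((n + 1) * besselTerm z n)) * (1 / (2 * √z)) +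
      ((n : ℝ) + 1) * besselTerm z n * (√z / 2)) (√z * (besselMoment z + besselSum z)) := by
    have e : √z * (besselMoment z + besselSum z) =
        z * (besselMoment z + besselSum z) * (1 / (2 * √z)) +
          (besselMoment z + besselSum z) * (√z / 2) := by
      field_simp
      rw [Real.sq_sqrt hz.le]
      ring
    rw [e]
    exact (hv2.mul_right (1 / (2 * √z))).add (hv.mul_right (√z / 2))
  -- The same AM-GM inequality against the weights `v n` gives `z * ∑ w n ≤ √z * ∑ v n`; dividing by
  -- `√z` leaves the claim.
  have h2 := hasSum_le (fun n => ?_) (hasSum_mul_succ_mul_besselTerm z) h1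
  · nth_rewrite 1 [← hsq] at h2
    rw [mul_assoc] at h2
    have := le_of_mul_le_mul_left h2 hs
    linarith
  · have : (n : ℝ) ≤ n ^ 2 * (1 / (2 * √z)) + √z / 2 := by
      rw [mul_one_div, div_add_div _ _ (by positivity) (by positivity), le_div_iff₀ (by positivity)]
      nlinarith [sq_nonneg ((n : ℝ) - √z), (n.cast_nonneg : (0 : ℝ) ≤ n)]
    have hb : 0 ≤ ((n : ℝ) + 1) * besselTerm z n :=
      mul_nonneg (by positivity) (besselTerm_nonneg hz.le n)
    nlinarith [mul_le_mul_of_nonneg_right this hb]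

end BesselSeries

/-! ### Integral representation of the Bessel series -/

section BesselIntegral

open Real

theorem integral_cos_pow_zero_pi (n : ℕ) :
    ∫ x in (0 : ℝ)..π, cos x ^ (n + 2) = (n + 1) / (n + 2) * ∫ x in (0 : ℝ)..π, cos x ^ n := by
  rw [integral_cos_pow]; simp

theorem integral_cos_pow_odd (m : ℕ) : ∫ x in (0 : ℝ)..π, cos x ^ (2 * m + 1) = 0 := by
  induction m with
  | zero => simp
  | succ m ih =>
    rw [show 2 * (m + 1) + 1 = (2 * m + 1) + 2 by ring, integral_cos_pow_zero_pi, ih, mul_zero]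

theorem integral_cos_pow_even (m : ℕ) :
    ∫ x in (0 : ℝ)..π, cos x ^ (2 * m) = π * (2 * m).factorial / (4 ^ m * m.factorial ^ 2) := by
  induction m with
  | zero => simp
  | succ m ih =>
    rw [show 2 * (m + 1) = 2 * m + 2 by ring, integral_cos_pow_zero_pi, ih]
    simp only [Nat.factorial_succ]
    push_cast
    have : (m.factorial : ℝ) ≠ 0 := by positivity
    field_simp
    ring

theorem integral_cos_pow_mul_sin_sq (n : ℕ) :
    ∫ x in (0 : ℝ)..π, cos x ^ n * sin x ^ 2 =
      1 / (n + 2) * ∫ x in (0 : ℝ)..π, cos x ^ n := by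
  have : ∀ x, cos x ^ n * sin x ^ 2 = cos x ^ n - cos x ^ (n + 2) := fun x => by
    rw [sin_sq]; ring
  simp only [this]
  rw [intervalIntegral.integral_sub ((by fun_prop : Continuous _).intervalIntegrable _ _)
    ((by fun_prop : Continuous _).intervalIntegrable _ _), integral_cos_pow_zero_pi]
  field_simp
  ring

/-- Expand the exponential and integrate term by term, dominated by the series of `exp (2 √z)`. Odd
powers of the cosine integrate to zero and the even ones are Wallis integrals. -/
theorem integral_exp_mul_cos_mul_sin_sq {z : ℝ} (hz : 0 ≤ z) :
    ∫ x in (0 : ℝ)..π, exp (2 * √z * cos x) * sin x ^ 2 = π / 2 * besselSum z := by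
  have h : HasSum (fun n : ℕ => ∫ x in (0 : ℝ)..π, (2 * √z * cos x) ^ n / n.factorial * sin x ^ 2)
      (∫ x in (0 : ℝ)..π, exp (2 * √z * cos x) * sin x ^ 2) := by
    refine intervalIntegral.hasSum_integral_of_dominated_convergence
      (fun n _ => (2 * √z) ^ n / n.factorial) (fun n => ?_) (fun n => ?_) ?_ ?_ ?_
    · exact (by fun_prop : Continuous _).aestronglyMeasurable
    · refine ae_of_all _ fun x _ => ?_
      rw [norm_mul, norm_div, norm_pow, norm_mul, norm_pow]
      simp only [norm_eq_abs, abs_of_nonneg (by positivity : 0 ≤ 2 * √z), Nat.abs_cast]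
      have h1 : |sin x| ^ 2 ≤ 1 := pow_le_one₀ (abs_nonneg _) (abs_sin_le_one x)
      have h2 : (2 * √z * |cos x|) ^ n ≤ (2 * √z) ^ n :=
        pow_le_pow_left₀ (by positivity)
          (mul_le_of_le_one_right (by positivity) (abs_cos_le_one x)) n
      calc _ ≤ (2 * √z) ^ n / n.factorial * 1 := by gcongr
        _ = _ := mul_one _
    · exact ae_of_all _ fun x _ => summable_pow_div_factorial _
    · exact intervalIntegrable_const
    · refine ae_of_all _ fun x _ => HasSum.mul_right _ ?_
      rw [exp_eq_exp_ℝ]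
      exact NormedSpace.expSeries_div_hasSum_exp _
  have h2 : HasSum (fun m : ℕ => ∫ x in (0 : ℝ)..π,
      (2 * √z * cos x) ^ (2 * m) / (2 * m).factorial * sin x ^ 2)
      (∫ x in (0 : ℝ)..π, exp (2 * √z * cos x) * sin x ^ 2) := by
    refine (Function.Injective.hasSum_iff (f := fun n : ℕ => ∫ x in (0 : ℝ)..π,
      (2 * √z * cos x) ^ n / n.factorial * sin x ^ 2) (g := fun m : ℕ => 2 * m)
      (mul_right_injective₀ two_ne_zero) fun n hn => ?_).2 h
    obtain ⟨m, rfl⟩ : Odd n := by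
      rw [← Nat.not_even_iff_odd]
      rintro ⟨m, rfl⟩
      exact hn ⟨m, by simp only; ring⟩
    have : ∀ x, (2 * √z * cos x) ^ (2 * m + 1) / (2 * m + 1).factorial * sin x ^ 2 =
        (2 * √z) ^ (2 * m + 1) / (2 * m + 1).factorial *
          (cos x ^ (2 * m + 1) * sin x ^ 2) := fun x => by
      rw [mul_pow _ (cos x)]; ring
    simp only [this, intervalIntegral.integral_const_mul, integral_cos_pow_mul_sin_sq,
      integral_cos_pow_odd, mul_zero]
  refine h2.unique ?_
  refine ((summable_besselTerm z).hasSum.mul_left (π / 2)).congr_fun fun m => ?_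
  have : ∀ x, (2 * √z * cos x) ^ (2 * m) / (2 * m).factorial * sin x ^ 2 =
      (4 * z) ^ m / (2 * m).factorial * (cos x ^ (2 * m) * sin x ^ 2) := fun x => by
    rw [mul_pow _ (cos x), pow_mul, mul_pow 2, sq_sqrt hz]; ring
  simp only [this, intervalIntegral.integral_const_mul, integral_cos_pow_mul_sin_sq,
    integral_cos_pow_even, besselTerm, Nat.factorial_succ]
  rw [mul_pow]
  have h1 : ((2 * m).factorial : ℝ) ≠ 0 := by positivity
  have h2 : (m.factorial : ℝ) ≠ 0 := by positivity
  push_cast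
  field_simp

end BesselIntegral

/-! ### Laplace's method for the Bessel function -/

section BesselAsymptotics

open Real

theorem integral_sq_mul_exp_neg_half_mul_sq :
    ∫ x in Set.Ioi (0 : ℝ), x ^ 2 * exp (-(1 / 2) * x ^ 2) = √(π / 2) := by
  have h := integral_rpow_mul_exp_neg_mul_rpow (p := 2) (q := 2) (b := 1 / 2) two_pos
    (by norm_num) (by norm_num)
  simp only [rpow_two] at h
  have h2 : (1 / 2 : ℝ) ^ (-(2 + 1) / 2 : ℝ) = 2 * √2 := by
    rw [show (-(2 + 1) / 2 : ℝ) = -(1 + 1 / 2) by norm_num, one_div, inv_rpow zero_le_two,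
      rpow_neg zero_le_two, inv_inv, rpow_add two_pos, rpow_one, ← one_div, ← sqrt_eq_rpow]
  rw [h, h2, show ((2 : ℝ) + 1) / 2 = 1 / 2 + 1 by norm_num, Gamma_add_one (by norm_num),
    Gamma_one_half_eq, sqrt_div' _ zero_le_two]
  have := sq_sqrt (zero_le_two (α := ℝ))
  field_simp
  rw [this]

/-- This Gaussian majorant, uniform in `m`, comes from `|sin θ| ≤ |θ|` and from `cos θ ≤ 1 - 2 θ² /
π²` for `|θ| ≤ π`. -/
theorem mul_sq_sin_div_le {m x : ℝ} (hm : 0 < m) (hx0 : 0 < x) (hx : x ≤ π * m) :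
    (m * sin (x / m)) ^ 2 * exp (m ^ 2 * (cos (x / m) - 1)) ≤
      x ^ 2 * exp (-(2 / π ^ 2) * x ^ 2) := by
  have h1 : |m * sin (x / m)| ≤ |x| := by
    rw [abs_mul, abs_of_pos hm, abs_of_pos hx0]
    have h := abs_sin_le_abs (x := x / m)
    rw [abs_of_pos (div_pos hx0 hm)] at h
    calc m * |sin (x / m)| ≤ m * (x / m) := by gcongr
      _ = x := mul_div_cancel₀ _ hm.ne'
  have h2 : (m * sin (x / m)) ^ 2 ≤ x ^ 2 := sq_le_sq.2 h1
  have h3 : m ^ 2 * (cos (x / m) - 1) ≤ -(2 / π ^ 2) * x ^ 2 := by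
    have hxm : |x / m| ≤ π := by
      rw [abs_of_pos (div_pos hx0 hm), div_le_iff₀ hm]; exact hx
    have := cos_le_one_sub_mul_cos_sq hxm
    calc m ^ 2 * (cos (x / m) - 1) ≤ m ^ 2 * (-(2 / π ^ 2 * (x / m) ^ 2)) := by
          gcongr; linarith
      _ = _ := by field_simp
  gcongr

theorem integrableOn_sq_mul_exp_neg_mul_sq {b : ℝ} (hb : 0 < b) :
    IntegrableOn (fun x : ℝ => x ^ 2 * exp (-b * x ^ 2)) (Set.Ioi 0) := by
  simpa only [rpow_two] using
    integrableOn_rpow_mul_exp_neg_mul_sq hb (s := 2) (by norm_num)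

theorem pow_three_mul_integral_eq {m : ℝ} (hm : 0 < m) :
    m ^ 3 * ∫ x in (0 : ℝ)..π, exp (m ^ 2 * (cos x - 1)) * sin x ^ 2 =
      ∫ x in Set.Ioi (0 : ℝ), (Set.Ioc 0 (π * m)).indicator
        (fun x => (m * sin (x / m)) ^ 2 * exp (m ^ 2 * (cos (x / m) - 1))) x := by
  rw [setIntegral_indicator measurableSet_Ioc,
    Set.inter_eq_self_of_subset_right Set.Ioc_subset_Ioi_self,
    ← intervalIntegral.integral_of_le (by positivity)]
  have h := intervalIntegral.integral_comp_div (a := 0) (b := π * m)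
    (fun x => (m * sin x) ^ 2 * exp (m ^ 2 * (cos x - 1))) hm.ne'
  rw [h, zero_div, mul_div_cancel_right₀ _ hm.ne', smul_eq_mul,
    ← intervalIntegral.integral_const_mul, ← intervalIntegral.integral_const_mul]
  congr 1
  ext x
  ring

theorem norm_indicator_le {m x : ℝ} (hm : 0 < m) :
    ‖(Set.Ioc 0 (π * m)).indicator
      (fun x => (m * sin (x / m)) ^ 2 * exp (m ^ 2 * (cos (x / m) - 1))) x‖ ≤
      x ^ 2 * exp (-(2 / π ^ 2) * x ^ 2) := by
  by_cases hx : x ∈ Set.Ioc 0 (π * m)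
  · rw [Set.indicator_of_mem hx, norm_of_nonneg (by positivity)]
    exact mul_sq_sin_div_le hm hx.1 hx.2
  · rw [Set.indicator_of_notMem hx, norm_zero]
    positivity

theorem pow_three_mul_integral_le {m : ℝ} (hm : 0 < m) :
    m ^ 3 * ∫ x in (0 : ℝ)..π, exp (m ^ 2 * (cos x - 1)) * sin x ^ 2 ≤
      ∫ x in Set.Ioi (0 : ℝ), x ^ 2 * exp (-(2 / π ^ 2) * x ^ 2) := by
  rw [pow_three_mul_integral_eq hm]
  refine integral_mono_of_nonneg ?_ (integrableOn_sq_mul_exp_neg_mul_sq (by positivity)) ?_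
  · exact ae_of_all _ fun x => Set.indicator_nonneg (fun _ _ => by positivity) x
  · exact ae_of_all _ fun x => (le_abs_self _).trans (norm_indicator_le hm)

theorem tendsto_pow_three_mul_integral :
    Tendsto (fun m : ℝ => m ^ 3 * ∫ x in (0 : ℝ)..π, exp (m ^ 2 * (cos x - 1)) * sin x ^ 2)
      atTop (𝓝 √(π / 2)) := by
  rw [← integral_sq_mul_exp_neg_half_mul_sq]
  have h : Tendsto (fun m : ℝ => ∫ x in Set.Ioi (0 : ℝ), (Set.Ioc 0 (π * m)).indicator
        (fun x => (m * sin (x / m)) ^ 2 * exp (m ^ 2 * (cos (x / m) - 1))) x)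
      atTop (𝓝 (∫ x in Set.Ioi (0 : ℝ), x ^ 2 * exp (-(1 / 2) * x ^ 2))) := by
    refine tendsto_integral_filter_of_dominated_convergence _ ?_ ?_
      (integrableOn_sq_mul_exp_neg_mul_sq (b := 2 / π ^ 2) (by positivity)) ?_
    · refine Eventually.of_forall fun m => ?_
      exact ((by fun_prop : Measurable fun x : ℝ =>
        (m * sin (x / m)) ^ 2 * exp (m ^ 2 * (cos (x / m) - 1))).indicator
        measurableSet_Ioc).aestronglyMeasurable
    · filter_upwards [eventually_gt_atTop 0] with m hm
      exact ae_of_all _ fun x => norm_indicator_le hm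
    · filter_upwards [ae_restrict_mem measurableSet_Ioi] with x hx
      have hx0 : (0 : ℝ) < x := hx
      -- With `cos θ - 1 = -2 sin² (θ / 2)`, everything is expressed by `sinc`, whose continuity at
      -- `0` gives the limit.
      have hev : (fun m : ℝ => (x * sinc (x / m)) ^ 2 *
          exp (-(1 / 2) * x ^ 2 * sinc (x / (2 * m)) ^ 2)) =ᶠ[atTop]
          (fun m => (Set.Ioc 0 (π * m)).indicator
            (fun x => (m * sin (x / m)) ^ 2 * exp (m ^ 2 * (cos (x / m) - 1))) x) := by
        filter_upwards [eventually_gt_atTop 0, eventually_ge_atTop (x / π)] with m hm hm2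
        have hmem : x ∈ Set.Ioc 0 (π * m) :=
          ⟨hx0, by rwa [div_le_iff₀ pi_pos, mul_comm] at hm2⟩
        rw [Set.indicator_of_mem hmem,
          sinc_of_ne_zero (by positivity), sinc_of_ne_zero (by positivity)]
        congr 1
        · congr 1; field_simp
        · congr 1
          rw [show x / m = 2 * (x / (2 * m)) by field_simp, cos_two_mul, cos_sq']
          field_simp
          ring
      refine Tendsto.congr' hev ?_
      have h1 : Tendsto (fun m : ℝ => sinc (x / m)) atTop (𝓝 1) := by
        rw [← sinc_zero]
        exact (continuous_sinc.tendsto 0).comp (tendsto_const_nhds.div_atTop tendsto_id)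
      have h2 : Tendsto (fun m : ℝ => sinc (x / (2 * m))) atTop (𝓝 1) := by
        rw [← sinc_zero]
        exact (continuous_sinc.tendsto 0).comp (tendsto_const_nhds.div_atTop
          (tendsto_id.const_mul_atTop two_pos))
      have h3 := ((h1.const_mul x).pow 2).mul
        ((continuous_exp.tendsto _).comp ((h2.pow 2).const_mul (-(1 / 2) * x ^ 2)))
      simpa using h3
  refine h.congr' ?_
  filter_upwards [eventually_gt_atTop 0] with m hm
  exact (pow_three_mul_integral_eq hm).symm

theorem exp_neg_mul_besselSum_eq {z : ℝ} (hz : 0 ≤ z) :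
    exp (-(2 * √z)) * besselSum z =
      2 / π * ∫ x in (0 : ℝ)..π, exp (√(2 * √z) ^ 2 * (cos x - 1)) * sin x ^ 2 := by
  have h : besselSum z = 2 / π * ∫ x in (0 : ℝ)..π, exp (2 * √z * cos x) * sin x ^ 2 := by
    rw [integral_exp_mul_cos_mul_sin_sq hz]; field_simp
  rw [h, mul_left_comm, ← intervalIntegral.integral_const_mul, sq_sqrt (by positivity)]
  congr 2
  ext x
  rw [← mul_assoc, ← exp_add]
  congr 2
  ring

theorem rpow_mul_exp_neg_mul_besselSum_eq {z : ℝ} (hz : 0 ≤ z) :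
    z ^ (3 / 4 : ℝ) * (exp (-(2 * √z)) * besselSum z) =
      1 / (√2 * π) * (√(2 * √z) ^ 3 *
        ∫ x in (0 : ℝ)..π, exp (√(2 * √z) ^ 2 * (cos x - 1)) * sin x ^ 2) := by
  rw [exp_neg_mul_besselSum_eq hz]
  have h1 : √(2 * √z) ^ 3 = 2 * √2 * z ^ (3 / 4 : ℝ) := by
    rw [sqrt_mul zero_le_two, mul_pow, sqrt_eq_rpow √z, sqrt_eq_rpow z, ← rpow_mul hz,
      ← rpow_natCast (z ^ _), ← rpow_mul hz, pow_succ, sq_sqrt zero_le_two]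
    norm_num
  rw [h1]
  have h2 : √2 ≠ 0 := by positivity
  field_simp

theorem tendsto_rpow_mul_exp_neg_mul_besselSum :
    Tendsto (fun z : ℝ => z ^ (3 / 4 : ℝ) * (exp (-(2 * √z)) * besselSum z)) atTop
      (𝓝 (1 / (2 * √π))) := by
  have h : Tendsto (fun z : ℝ => √(2 * √z)) atTop atTop :=
    tendsto_sqrt_atTop.comp (tendsto_sqrt_atTop.const_mul_atTop two_pos)
  have h2 := (tendsto_pow_three_mul_integral.comp h).const_mul (1 / (√2 * π))
  have e : 1 / (√2 * π) * √(π / 2) = 1 / (2 * √π) := by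
    rw [sqrt_div' _ zero_le_two]
    have h2 : √2 ≠ 0 := by positivity
    have h3 : √π ≠ 0 := by positivity
    field_simp
    rw [sq_sqrt zero_le_two, sq_sqrt pi_pos.le, mul_comm]
  rw [e] at h2
  refine h2.congr' ?_
  filter_upwards [eventually_ge_atTop 0] with z hz
  exact (rpow_mul_exp_neg_mul_besselSum_eq hz).symm

/-- The weighted bound is sharp for large `z`; the unweighted one serves near the edge `y = c₀ t` of
the support, where the argument may be small. The constant `2` is `2 / π * π`, from bounding the
integrand by `1`. -/
theorem exists_besselSum_bound : ∃ C : ℝ, 0 < C ∧ ∀ z, 0 ≤ z →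
    exp (-(2 * √z)) * besselSum z ≤ C ∧
    z ^ (3 / 4 : ℝ) * (exp (-(2 * √z)) * besselSum z) ≤ C := by
  refine ⟨max 2 (1 / (√2 * π) * ∫ x in Set.Ioi (0 : ℝ), x ^ 2 * exp (-(2 / π ^ 2) * x ^ 2)),
    lt_max_of_lt_left two_pos, fun z hz => ⟨le_max_of_le_left ?_, ?_⟩⟩
  · rw [exp_neg_mul_besselSum_eq hz]
    have : ∫ x in (0 : ℝ)..π, exp (√(2 * √z) ^ 2 * (cos x - 1)) * sin x ^ 2 ≤
        ∫ x in (0 : ℝ)..π, (1 : ℝ) := by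
      refine intervalIntegral.integral_mono_on pi_pos.le
        ((by fun_prop : Continuous _).intervalIntegrable _ _)
        (intervalIntegrable_const) fun x _ => ?_
      refine mul_le_one₀ ?_ (sq_nonneg _) (sin_sq_le_one x)
      rw [exp_le_one_iff]
      exact mul_nonpos_of_nonneg_of_nonpos (sq_nonneg _) (sub_nonpos.2 (cos_le_one x))
    simp only [intervalIntegral.integral_const, sub_zero, smul_eq_mul, mul_one] at this
    calc _ ≤ 2 / π * π := by gcongr
      _ = 2 := by field_simp
  · rcases hz.eq_or_lt with rfl | hz'
    · rw [zero_rpow (by norm_num), zero_mul]; positivity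
    · refine le_max_of_le_right ?_
      rw [rpow_mul_exp_neg_mul_besselSum_eq hz]
      gcongr
      exact pow_three_mul_integral_le (by positivity)

end BesselAsymptotics

/-! ### Closed form of the densities after summation over the stages -/

section ClosedForm

open scoped ENNReal

/-- The product of the numbers of switches expected in the up time and in the down time. -/
noncomputable def besselArg (l₀ l₁ c₀ c₁ y t : ℝ) : ℝ :=
  l₀ * l₁ * upTime c₀ c₁ y t * downTime c₀ c₁ y t

/-- The density of the first passage time through `y`, starting in the upward direction. -/
noncomputable def passageDensity (l₀ l₁ c₀ c₁ y t : ℝ) : ℝ :=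
  if y < c₀ * t then
    l₀ * l₁ * y / (c₀ + c₁) * besselSum (besselArg l₀ l₁ c₀ c₁ y t) *
      Real.exp (-(l₀ * upTime c₀ c₁ y t) - l₁ * downTime c₀ c₁ y t)
  else 0

/-- The ratio of the densities of the first passage times for the two starting directions. -/
noncomputable def passageRatio (l₀ l₁ c₀ c₁ y t : ℝ) : ℝ :=
  c₀ / (l₀ * y) + besselMoment (besselArg l₀ l₁ c₀ c₁ y t) /
    (l₀ * upTime c₀ c₁ y t * besselSum (besselArg l₀ l₁ c₀ c₁ y t))

theorem measurable_passageDensity (l₀ l₁ c₀ c₁ y : ℝ) :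
    Measurable (passageDensity l₀ l₁ c₀ c₁ y) := by
  have := continuous_besselSum.measurable
  refine Measurable.ite (measurableSet_lt measurable_const (by fun_prop)) ?_ measurable_const
  unfold besselArg upTime downTime
  fun_prop

theorem measurable_passageRatio (l₀ l₁ c₀ c₁ y : ℝ) :
    Measurable (passageRatio l₀ l₁ c₀ c₁ y) := by
  have := continuous_besselSum.measurable
  have := continuous_besselMoment.measurable
  unfold passageRatio besselArg upTime downTime
  fun_prop

variable {l₀ l₁ c₀ c₁ y t : ℝ}

theorem downTime_pos (hc₀ : 0 < c₀) (hc₁ : 0 < c₁) (ht : y < c₀ * t) :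
    0 < downTime c₀ c₁ y t :=
  div_pos (by linarith) (by positivity)

theorem upTime_pos (hc₀ : 0 < c₀) (hc₁ : 0 < c₁) (hy : 0 < y) (ht : y < c₀ * t) :
    0 < upTime c₀ c₁ y t := by
  have : 0 < t := pos_of_mul_pos_right (hy.trans ht) hc₀.le
  unfold upTime; positivity

variable (hl₀ : 0 < l₀) (hl₁ : 0 < l₁) (hc₀ : 0 < c₀) (hc₁ : 0 < c₁) (hy : 0 < y)

include hl₀ hl₁ hc₀ hc₁ hy

theorem besselArg_pos (ht : y < c₀ * t) : 0 < besselArg l₀ l₁ c₀ c₁ y t := by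
  have := downTime_pos hc₀ hc₁ ht
  have := upTime_pos hc₀ hc₁ hy ht
  unfold besselArg; positivity

theorem passageDensity_nonneg (t : ℝ) : 0 ≤ passageDensity l₀ l₁ c₀ c₁ y t := by
  unfold passageDensity
  split_ifs with ht
  · have := besselSum_pos (besselArg_pos hl₀ hl₁ hc₀ hc₁ hy ht).le
    positivity
  · rfl

theorem passageRatio_nonneg (ht : y < c₀ * t) : 0 ≤ passageRatio l₀ l₁ c₀ c₁ y t := by
  have h := besselArg_pos hl₀ hl₁ hc₀ hc₁ hy ht
  have := besselSum_pos h.le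
  have := besselMoment_nonneg h.le
  have := upTime_pos hc₀ hc₁ hy ht
  unfold passageRatio
  positivity

theorem tsum_upDensity (t : ℝ) :
    ∑' n, ENNReal.ofReal (upDensity l₀ l₁ c₀ c₁ n y t) =
      ENNReal.ofReal (passageDensity l₀ l₁ c₀ c₁ y t) := by
  by_cases ht : y < c₀ * t
  · have hz := besselArg_pos hl₀ hl₁ hc₀ hc₁ hy ht
    have h : HasSum (fun n => upDensity l₀ l₁ c₀ c₁ n y t)
        (passageDensity l₀ l₁ c₀ c₁ y t) := by
      simp only [upDensity, passageDensity, if_pos ht, hy, true_and]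
      exact ((summable_besselTerm _).hasSum.mul_left _).mul_right _
    rw [← h.tsum_eq, ENNReal.ofReal_tsum_of_nonneg _ h.summable]
    intro n
    simp only [upDensity, ht, hy, true_and, if_true]
    have : 0 ≤ (l₀ * l₁ * upTime c₀ c₁ y t * downTime c₀ c₁ y t) ^ n := pow_nonneg hz.le n
    positivity
  · simp [upDensity, passageDensity, ht]

theorem tsum_downDensity (t : ℝ) :
    ∑' n, ENNReal.ofReal (downDensity l₀ l₁ c₀ c₁ n y t) =
      ENNReal.ofReal (passageDensity l₀ l₁ c₀ c₁ y t * passageRatio l₀ l₁ c₀ c₁ y t) := by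
  by_cases ht : y < c₀ * t
  · have hz := besselArg_pos hl₀ hl₁ hc₀ hc₁ hy ht
    have hh := besselSum_pos hz.le
    have hu := upTime_pos hc₀ hc₁ hy ht
    set z := besselArg l₀ l₁ c₀ c₁ y t with hz_def
    set u := upTime c₀ c₁ y t with hu_def
    have e : passageDensity l₀ l₁ c₀ c₁ y t * passageRatio l₀ l₁ c₀ c₁ y t =
        l₁ * c₀ / (c₀ + c₁) * (besselSum z + y / (c₀ * u) * besselMoment z) *
          Real.exp (-(l₀ * u) - l₁ * downTime c₀ c₁ y t) := by
      rw [passageDensity, if_pos ht, passageRatio, ← hz_def, ← hu_def]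
      field_simp
    have h : HasSum (fun n => downDensity l₀ l₁ c₀ c₁ n y t)
        (passageDensity l₀ l₁ c₀ c₁ y t * passageRatio l₀ l₁ c₀ c₁ y t) := by
      rw [e]
      refine ((((summable_besselTerm z).hasSum.add
        ((summable_natCast_mul_besselTerm z).hasSum.mul_left (y / (c₀ * u)))).mul_left
          (l₁ * c₀ / (c₀ + c₁))).mul_right
          (Real.exp (-(l₀ * u) - l₁ * downTime c₀ c₁ y t))).congr_fun fun n => ?_
      simp only [downDensity, ht, hy, true_and, if_true, ← hu_def]
      change _ = l₁ * c₀ / (c₀ + c₁) * (besselTerm (l₀ * l₁ * u * downTime c₀ c₁ y t) n + y / (c₀ * u) *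
        (n * besselTerm (l₀ * l₁ * u * downTime c₀ c₁ y t) n)) * _
      rw [besselTerm]
      ring
    rw [← h.tsum_eq, ENNReal.ofReal_tsum_of_nonneg _ h.summable]
    intro n
    simp only [downDensity, ht, hy, true_and, if_true, ← hu_def]
    have : 0 ≤ (l₀ * l₁ * u * downTime c₀ c₁ y t) ^ n := pow_nonneg hz.le n
    positivity
  · simp [downDensity, passageDensity, ht]

omit hl₀ hl₁ hc₀ hc₁ hy in
theorem continuousAt_passageDensity (ht : y < c₀ * t) :
    ContinuousAt (passageDensity l₀ l₁ c₀ c₁ y) t := by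
  have hc : ContinuousAt (fun t => l₀ * l₁ * y / (c₀ + c₁) *
      besselSum (besselArg l₀ l₁ c₀ c₁ y t) *
      Real.exp (-(l₀ * upTime c₀ c₁ y t) - l₁ * downTime c₀ c₁ y t)) t := by
    have := continuous_besselSum
    unfold besselArg upTime downTime
    fun_prop
  refine hc.congr ?_
  filter_upwards [(by fun_prop : Continuous fun s => c₀ * s).continuousAt.eventually_const_lt ht]
    with s hs
  rw [passageDensity, if_pos hs]

theorem continuousAt_passageRatio (ht : y < c₀ * t) :
    ContinuousAt (passageRatio l₀ l₁ c₀ c₁ y) t := by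
  have h0 := upTime_pos hc₀ hc₁ hy ht
  have h1 := besselSum_pos (besselArg_pos hl₀ hl₁ hc₀ hc₁ hy ht).le
  have hu : Continuous (upTime c₀ c₁ y) := by unfold upTime; fun_prop
  have hd : Continuous (downTime c₀ c₁ y) := by unfold downTime; fun_prop
  have hz : Continuous (besselArg l₀ l₁ c₀ c₁ y) := by unfold besselArg; fun_prop
  unfold passageRatio
  refine continuousAt_const.add (ContinuousAt.div ?_ ?_ (by positivity))
  · exact (continuous_besselMoment.comp hz).continuousAt
  · exact ((continuous_const.mul hu).mul (continuous_besselSum.comp hz)).continuousAt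

end ClosedForm

/-! ### Measures with one atom and a density -/

section AtomAndDensity

variable {μ : Measure ℝ} {A b : ℝ} {f : ℝ → ℝ}

open scoped ENNReal

/-- A measure with an atom of mass `A` at `b` and with the density `f` away from it. -/
structure HasAtomAndDensity (μ : Measure ℝ) (A b : ℝ) (f : ℝ → ℝ) : Prop where
  mass_nonneg : 0 ≤ A
  measurable : Measurable f
  nonneg : ∀ t, 0 ≤ f t
  eq_zero : ∀ t ≤ b, f t = 0
  lintegral_eq : ∀ φ : ℝ → ℝ≥0∞, Measurable φ →
    ∫⁻ t, φ t ∂μ = ENNReal.ofReal A * φ b + ∫⁻ t, φ t * ENNReal.ofReal (f t)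

theorem HasAtomAndDensity.eq (h : HasAtomAndDensity μ A b f) :
    μ = ENNReal.ofReal A • Measure.dirac b + volume.withDensity fun t => ENNReal.ofReal (f t) := by
  ext s hs
  have h1 := h.lintegral_eq (s.indicator 1) (measurable_one.indicator hs)
  rw [lintegral_indicator_one hs] at h1
  rw [h1, Measure.add_apply, Measure.smul_apply, Measure.dirac_apply' _ hs,
    withDensity_apply _ hs, smul_eq_mul, ← lintegral_indicator hs]
  congr 1
  refine lintegral_congr fun t => ?_
  by_cases ht : t ∈ s <;> simp [ht]

theorem HasAtomAndDensity.integrable (h : HasAtomAndDensity μ A b f) [IsFiniteMeasure μ] :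
    Integrable f := by
  refine ⟨h.measurable.aestronglyMeasurable, ?_⟩
  rw [hasFiniteIntegral_iff_ofReal (ae_of_all _ h.nonneg)]
  have h1 := h.lintegral_eq (fun _ => 1) measurable_const
  simp only [lintegral_one, one_mul] at h1
  refine lt_of_le_of_lt ?_ (measure_lt_top μ Set.univ)
  rw [h1]
  exact le_add_self

theorem HasAtomAndDensity.integral_eq (h : HasAtomAndDensity μ A b f) [IsFiniteMeasure μ]
    (hb : 0 ≤ b) (g : BoundedContinuousFunction ℝ ℝ) :
    ∫ t, g t ∂μ = A * g b + ∫ t in Set.Ioi 0, g t * f t := by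
  have hg : Integrable g μ := g.integrable μ
  have heq := h.eq
  rw [heq] at hg ⊢
  rw [integral_add_measure (hg.mono_measure (Measure.le_add_right le_rfl))
    (hg.mono_measure (Measure.le_add_left le_rfl)), integral_smul_measure, integral_dirac,
    ENNReal.toReal_ofReal h.mass_nonneg, smul_eq_mul,
    integral_withDensity_eq_integral_toReal_smul h.measurable.ennreal_ofReal
      (ae_of_all _ fun _ => ENNReal.ofReal_lt_top)]
  congr 1
  rw [setIntegral_eq_integral_of_forall_compl_eq_zero]
  · refine integral_congr_ae (ae_of_all _ fun t => ?_)
    simp only [ENNReal.toReal_ofReal (h.nonneg t), smul_eq_mul, mul_comm]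
  · intro t ht
    rw [h.eq_zero t ((not_lt.1 ht).trans hb), mul_zero]

theorem HasAtomAndDensity.hasDerivAt (h : HasAtomAndDensity μ A b f) [IsFiniteMeasure μ]
    {t : ℝ} (ht : b < t) (hf : ContinuousAt f t) :
    HasDerivAt (fun s => μ.real (Set.Iic s)) (f t) t := by
  have hint := h.integrable
  -- Beyond the atom the distribution function is a constant plus the integral of the density, so
  -- the fundamental theorem of calculus applies.
  have hcdf : ∀ s, b < s → μ.real (Set.Iic s) = A + (∫ x in Set.Iic b, f x) + ∫ x in b..s, f x := by
    intro s hs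
    rw [← intervalIntegral.integral_Iic_sub_Iic hint.integrableOn hint.integrableOn]
    have h1 := h.lintegral_eq ((Set.Iic s).indicator 1) (measurable_one.indicator measurableSet_Iic)
    rw [lintegral_indicator_one measurableSet_Iic, Set.indicator_of_mem (Set.mem_Iic.2 hs.le)] at h1
    have h2 : ∫⁻ t, (Set.Iic s).indicator 1 t * ENNReal.ofReal (f t) =
        ENNReal.ofReal (∫ x in Set.Iic s, f x) := by
      rw [ofReal_integral_eq_lintegral_ofReal hint.integrableOn (ae_of_all _ h.nonneg),
        ← lintegral_indicator measurableSet_Iic]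
      refine lintegral_congr fun t => ?_
      by_cases ht : t ∈ Set.Iic s <;> simp [Set.indicator, ht]
    have h3 : 0 ≤ ∫ x in Set.Iic s, f x := integral_nonneg h.nonneg
    rw [Measure.real, h1, h2, Pi.one_apply, mul_one, ← ENNReal.ofReal_add h.mass_nonneg h3,
      ENNReal.toReal_ofReal (add_nonneg h.mass_nonneg h3)]
    ring
  have hd : HasDerivAt (fun s => ∫ x in b..s, f x) (f t) t :=
    intervalIntegral.integral_hasDerivAt_right hint.intervalIntegrable
      h.measurable.stronglyMeasurable.stronglyMeasurableAtFilter hf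
  refine (hd.const_add (A + ∫ x in Set.Iic b, f x)).congr_of_eventuallyEq ?_
  filter_upwards [eventually_gt_nhds ht] with s hs
  exact hcdf s hs

end AtomAndDensity

section LawDensity

variable {Ω : Type*} [MeasurableSpace Ω] {P : Measure Ω}
    [IsProbabilityMeasure P] {lam γ : Fin 2 → ℝ} {ε : ℝ → Ω → Fin 2} {y : ℝ}

theorem isFiniteMeasure_firstPassageLaw (γ : Fin 2 → ℝ) (ε : ℝ → Ω → Fin 2) (y : ℝ) :
    IsFiniteMeasure (firstPassageLaw γ ε P y) := by
  unfold firstPassageLaw; infer_instance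

theorem hasAtomAndDensity_firstPassageLaw_up (hlam : ∀ j, 0 < lam j)
    (hε : IsTwoStateMarkov lam 0 P ε) (hγ₀ : 0 < γ 0) (hγ₁ : γ 1 < 0) (hy : 0 < y) :
    HasAtomAndDensity (firstPassageLaw γ ε P y) (Real.exp (-(lam 0 * (y / γ 0)))) (y / γ 0)
      (passageDensity (lam 0) (lam 1) (γ 0) (-γ 1) y) where
  mass_nonneg := (Real.exp_pos _).le
  measurable := measurable_passageDensity _ _ _ _ _
  nonneg := passageDensity_nonneg (hlam 0) (hlam 1) hγ₀ (neg_pos.2 hγ₁) hy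
  eq_zero t ht := if_neg (by rw [le_div_iff₀ hγ₀] at ht; linarith)
  lintegral_eq φ hφ := by
    rw [lintegral_firstPassageLaw_up hlam hε hγ₀ hγ₁ hy hφ]
    simp only [tsum_upDensity (hlam 0) (hlam 1) hγ₀ (neg_pos.2 hγ₁) hy]

theorem hasAtomAndDensity_firstPassageLaw_down (hlam : ∀ j, 0 < lam j)
    (hε : IsTwoStateMarkov lam 1 P ε) (hγ₀ : 0 < γ 0) (hγ₁ : γ 1 < 0) (hy : 0 < y) :
    HasAtomAndDensity (firstPassageLaw γ ε P y) 0 (y / γ 0)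
      (fun t => passageDensity (lam 0) (lam 1) (γ 0) (-γ 1) y t *
        passageRatio (lam 0) (lam 1) (γ 0) (-γ 1) y t) where
  mass_nonneg := le_rfl
  measurable := (measurable_passageDensity _ _ _ _ _).mul (measurable_passageRatio _ _ _ _ _)
  nonneg t := by
    by_cases ht : y < γ 0 * t
    · exact mul_nonneg (passageDensity_nonneg (hlam 0) (hlam 1) hγ₀ (neg_pos.2 hγ₁) hy t)
        (passageRatio_nonneg (hlam 0) (hlam 1) hγ₀ (neg_pos.2 hγ₁) hy ht)
    · simp [passageDensity, ht]
  eq_zero t ht := by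
    rw [passageDensity, if_neg (by rw [le_div_iff₀ hγ₀] at ht; linarith), zero_mul]
  lintegral_eq φ hφ := by
    rw [lintegral_firstPassageLaw_down hlam hε hγ₀ hγ₁ hy hφ]
    simp only [tsum_downDensity (hlam 0) (hlam 1) hγ₀ (neg_pos.2 hγ₁) hy, ENNReal.ofReal_zero,
      zero_mul, zero_add]

end LawDensity

/-! ### The densities in Kac's variables -/

section Scaling

open Real

theorem rpow_pow_four_mul {r x : ℝ} (hr : 0 ≤ r) (hx : 0 ≤ x) :
    (r ^ 4 * x) ^ (3 / 4 : ℝ) = r ^ 3 * x ^ (3 / 4 : ℝ) := by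
  rw [mul_rpow (by positivity) hx, ← rpow_natCast r 4, ← rpow_mul hr, ← rpow_natCast r 3]
  norm_num

variable {r a p m y t δ : ℝ}

theorem upTime_scaled (hr : 0 < r) : upTime (p * r) (m * r) y t = (m * t + y / r) / (p + m) := by
  rw [upTime, ← add_mul, mul_comm (p + m), ← div_div]
  congr 1
  field_simp

theorem downTime_scaled (hr : 0 < r) :
    downTime (p * r) (m * r) y t = (p * t - y / r) / (p + m) := by
  rw [downTime, ← add_mul, mul_comm (p + m), ← div_div]
  congr 1
  field_simp

theorem besselArg_scaled : besselArg (a * r ^ 2) (r ^ 2) (p * r) (m * r) y t =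
    r ^ 4 * (a * upTime (p * r) (m * r) y t * downTime (p * r) (m * r) y t) := by
  rw [besselArg]; ring

theorem sqrt_besselArg_scaled : √(besselArg (a * r ^ 2) (r ^ 2) (p * r) (m * r) y t) =
    r ^ 2 * √(a * upTime (p * r) (m * r) y t * downTime (p * r) (m * r) y t) := by
  rw [besselArg_scaled, sqrt_mul (by positivity), show r ^ 4 = (r ^ 2) ^ 2 by ring,
    sqrt_sq (by positivity)]

variable (hr : 0 < r) (ha : 0 < a) (hp : 0 < p) (hm : 0 < m) (hy : 0 < y)
  (hδ : r * (p - m * a) = δ * (a + 1))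

include hr ha hp hm hy hδ

/-- The growing factor `exp (2 √z)` is taken out of the Bessel function and completes the square in
the exponent. The drift relation `hδ` turns `a * u - d` into `(a + 1) * (y - δ * t) / ((p + m) *
r)`, so that no large parameter is left in the last exponent. -/
theorem passageDensity_scaled (ht : y < p * r * t) :
    passageDensity (a * r ^ 2) (r ^ 2) (p * r) (m * r) y t =
      y * (a * r ^ 3 / (p + m)) *
      (exp (-(2 * √(besselArg (a * r ^ 2) (r ^ 2) (p * r) (m * r) y t))) *
        besselSum (besselArg (a * r ^ 2) (r ^ 2) (p * r) (m * r) y t)) *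
      exp (-((a + 1) * (y - δ * t) / ((p + m) * (√(a * upTime (p * r) (m * r) y t) +
        √(downTime (p * r) (m * r) y t)))) ^ 2) := by
  have hu := upTime_pos (by positivity : 0 < p * r) (by positivity : 0 < m * r) hy ht
  have hd := downTime_pos (by positivity : 0 < p * r) (by positivity : 0 < m * r) ht
  have hau : a * upTime (p * r) (m * r) y t - downTime (p * r) (m * r) y t =
      (a + 1) * (y - δ * t) / ((p + m) * r) := by
    have : (a + 1) * (y - δ * t) = (a + 1) * y - r * (p - m * a) * t := by rw [hδ]; ring
    rw [this, upTime_scaled hr, downTime_scaled hr]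
    field_simp
    ring
  rw [passageDensity, if_pos ht, sqrt_besselArg_scaled]
  set u := upTime (p * r) (m * r) y t
  set d := downTime (p * r) (m * r) y t
  have hsu : 0 < √(a * u) := sqrt_pos.2 (by positivity)
  have hsd : 0 < √d := sqrt_pos.2 hd
  have h1 : (√(a * u) - √d) * (√(a * u) + √d) = a * u - d := by
    nlinarith [mul_self_sqrt hd.le, mul_self_sqrt (by positivity : 0 ≤ a * u)]
  have hQ : (a + 1) * (y - δ * t) / ((p + m) * (√(a * u) + √d)) = r * (√(a * u) - √d) := by
    rw [div_eq_iff (by positivity)]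
    rw [eq_div_iff (by positivity)] at hau
    rw [← hau, ← h1]
    ring
  have hexp : -(a * r ^ 2 * u) - r ^ 2 * d =
      -(2 * (r ^ 2 * √(a * u * d))) + -(r * (√(a * u) - √d)) ^ 2 := by
    rw [sqrt_mul (by positivity)]
    have h2 : √(a * u) * √(a * u) = a * u := mul_self_sqrt (by positivity)
    have h3 : √d * √d = d := mul_self_sqrt hd.le
    have : (r * (√(a * u) - √d)) ^ 2 =
      r ^ 2 * (√(a * u) * √(a * u) + √d * √d - 2 * (√(a * u) * √d)) := by ring
    rw [this, h2, h3]
    ring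
  rw [hexp, hQ, exp_add]
  field_simp

omit hδ in
theorem passageRatio_scaled_le (ht : y < p * r * t) :
    passageRatio (a * r ^ 2) (r ^ 2) (p * r) (m * r) y t ≤ p / (a * r * y) +
      √(a * upTime (p * r) (m * r) y t * downTime (p * r) (m * r) y t) /
        (a * upTime (p * r) (m * r) y t) := by
  have hz := besselArg_pos (by positivity : 0 < a * r ^ 2) (by positivity : 0 < r ^ 2)
    (by positivity : 0 < p * r) (by positivity : 0 < m * r) hy ht
  have hu := upTime_pos (by positivity : 0 < p * r) (by positivity : 0 < m * r) hy ht
  have hh := besselSum_pos hz.le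
  have hle := besselMoment_le hz
  rw [sqrt_besselArg_scaled] at hle
  unfold passageRatio
  refine add_le_add (le_of_eq (by field_simp)) ?_
  rw [div_le_div_iff₀ (by positivity) (by positivity)]
  have := mul_le_mul_of_nonneg_right hle (by positivity : 0 ≤ a * upTime (p * r) (m * r) y t)
  linarith

omit hδ in
theorem le_passageRatio_scaled (ht : y < p * r * t) :
    √(a * upTime (p * r) (m * r) y t * downTime (p * r) (m * r) y t) /
      (a * upTime (p * r) (m * r) y t) - 1 / (a * upTime (p * r) (m * r) y t * r ^ 2) ≤
        passageRatio (a * r ^ 2) (r ^ 2) (p * r) (m * r) y t := by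
  have hz := besselArg_pos (by positivity : 0 < a * r ^ 2) (by positivity : 0 < r ^ 2)
    (by positivity : 0 < p * r) (by positivity : 0 < m * r) hy ht
  have hu := upTime_pos (by positivity : 0 < p * r) (by positivity : 0 < m * r) hy ht
  have hh := besselSum_pos hz.le
  have hle := le_besselMoment hz
  rw [sqrt_besselArg_scaled] at hle
  unfold passageRatio
  refine le_add_of_nonneg_of_le (by positivity) ?_
  rw [le_div_iff₀ (by positivity)]
  refine le_trans (le_of_eq ?_) hle
  generalize besselSum (besselArg (a * r ^ 2) (r ^ 2) (p * r) (m * r) y t) = h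
  generalize √(a * upTime (p * r) (m * r) y t * downTime (p * r) (m * r) y t) = q
  generalize upTime (p * r) (m * r) y t = u at hu
  field_simp

end Scaling

/-! ### Pointwise limits of the density and of the ratio -/

section Limits

open Real

variable {ι : Type*} {l : Filter ι} {r a p m : ι → ℝ} {δ : ι → ℝ} {ν σ δ₀ y t : ℝ}

theorem tendsto_upTime_scaled (hr : Tendsto r l atTop) (hp : Tendsto p l (𝓝 (ν ^ 2 * σ)))
    (hm : Tendsto m l (𝓝 σ)) (hσ : 0 < σ) :
    Tendsto (fun n => upTime (p n * r n) (m n * r n) y t) l (𝓝 (t / (1 + ν ^ 2))) := by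
  have h1 : Tendsto (fun n => (m n * t + y / r n) / (p n + m n)) l
      (𝓝 ((σ * t + 0) / (ν ^ 2 * σ + σ))) :=
    ((hm.mul_const t).add (tendsto_const_nhds.div_atTop hr)).div (hp.add hm) (by positivity)
  rw [show (σ * t + 0) / (ν ^ 2 * σ + σ) = t / (1 + ν ^ 2) by field_simp; ring] at h1
  refine h1.congr' ?_
  filter_upwards [hr.eventually_gt_atTop 0] with n hn
  exact (upTime_scaled hn).symm

theorem tendsto_downTime_scaled (hr : Tendsto r l atTop) (hp : Tendsto p l (𝓝 (ν ^ 2 * σ)))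
    (hm : Tendsto m l (𝓝 σ)) (hσ : 0 < σ) :
    Tendsto (fun n => downTime (p n * r n) (m n * r n) y t) l
      (𝓝 (ν ^ 2 * t / (1 + ν ^ 2))) := by
  have h1 : Tendsto (fun n => (p n * t - y / r n) / (p n + m n)) l
      (𝓝 ((ν ^ 2 * σ * t - 0) / (ν ^ 2 * σ + σ))) :=
    ((hp.mul_const t).sub (tendsto_const_nhds.div_atTop hr)).div (hp.add hm) (by positivity)
  rw [show (ν ^ 2 * σ * t - 0) / (ν ^ 2 * σ + σ) = ν ^ 2 * t / (1 + ν ^ 2) by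
    field_simp; ring] at h1
  refine h1.congr' ?_
  filter_upwards [hr.eventually_gt_atTop 0] with n hn
  exact (downTime_scaled hn).symm

theorem eventually_lt_mul (hr : Tendsto r l atTop) (hp : Tendsto p l (𝓝 (ν ^ 2 * σ)))
    (hν : 0 < ν) (hσ : 0 < σ) (ht : 0 < t) : ∀ᶠ n in l, y < p n * r n * t := by
  have : Tendsto (fun n => p n * r n * t) l atTop :=
    (hp.pos_mul_atTop (by positivity) hr).atTop_mul_const ht
  exact this.eventually_gt_atTop y

variable (hr : Tendsto r l atTop) (ha : Tendsto a l (𝓝 (ν ^ 2)))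
  (hp : Tendsto p l (𝓝 (ν ^ 2 * σ))) (hm : Tendsto m l (𝓝 σ))
  (hν : 0 < ν) (hσ : 0 < σ) (hy : 0 < y)

include hr ha hp hm hν hσ hy

/-- Both bounds of the squeeze have the main term `√(a u d) / (a u)`, whose limit is `1` because `a
u` and `d` have the same limit; the corrections are of orders `1 / r` and `1 / r ^ 2`. -/
theorem tendsto_passageRatio_scaled (ht : 0 < t) :
    Tendsto (fun n => passageRatio (a n * r n ^ 2) (r n ^ 2) (p n * r n) (m n * r n) y t) l
      (𝓝 1) := by
  have hu := tendsto_upTime_scaled (y := y) (t := t) hr hp hm hσ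
  have hd := tendsto_downTime_scaled (y := y) (t := t) hr hp hm hσ
  have h1 : Tendsto (fun n => √(a n * upTime (p n * r n) (m n * r n) y t *
      downTime (p n * r n) (m n * r n) y t) / (a n * upTime (p n * r n) (m n * r n) y t)) l
      (𝓝 1) := by
    have := ((continuous_sqrt.tendsto _).comp ((ha.mul hu).mul hd)).div (ha.mul hu) (by positivity)
    rw [show ν ^ 2 * (t / (1 + ν ^ 2)) * (ν ^ 2 * t / (1 + ν ^ 2)) =
      (ν ^ 2 * (t / (1 + ν ^ 2))) ^ 2 by field_simp, sqrt_sq (by positivity),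
      div_self (by positivity)] at this
    exact this
  have h2 : Tendsto (fun n => p n / (a n * r n * y)) l (𝓝 0) :=
    hp.div_atTop ((ha.pos_mul_atTop (by positivity) hr).atTop_mul_const hy)
  have h3 : Tendsto (fun n => 1 / (a n * upTime (p n * r n) (m n * r n) y t * r n ^ 2)) l (𝓝 0) :=
    tendsto_const_nhds.div_atTop ((ha.mul hu).pos_mul_atTop (by positivity)
      ((tendsto_pow_atTop two_ne_zero).comp hr))
  have hev : ∀ᶠ n in l, 0 < r n ∧ 0 < a n ∧ 0 < p n ∧ 0 < m n ∧ y < p n * r n * t := by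
    filter_upwards [hr.eventually_gt_atTop 0, ha.eventually_const_lt (by positivity : 0 < ν ^ 2),
      hp.eventually_const_lt (by positivity : 0 < ν ^ 2 * σ), hm.eventually_const_lt hσ,
      eventually_lt_mul (y := y) hr hp hν hσ ht] with n h1 h2 h3 h4 h5
    exact ⟨h1, h2, h3, h4, h5⟩
  have h4 := h1.sub h3
  have h5 := h2.add h1
  rw [sub_zero] at h4
  rw [zero_add] at h5
  refine tendsto_of_tendsto_of_tendsto_of_le_of_le' h4 h5 ?_ ?_
  · filter_upwards [hev] with n ⟨h1, h2, h3, h4, h5⟩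
    exact le_passageRatio_scaled h1 h2 h3 h4 hy h5
  · filter_upwards [hev] with n ⟨h1, h2, h3, h4, h5⟩
    exact passageRatio_scaled_le h1 h2 h3 h4 hy h5

theorem tendsto_passageDensity_scaled (hδ : Tendsto δ l (𝓝 δ₀))
    (hrel : ∀ n, r n * (p n - m n * a n) = δ n * (a n + 1)) (ht : 0 < t) :
    Tendsto (fun n => passageDensity (a n * r n ^ 2) (r n ^ 2) (p n * r n) (m n * r n) y t) l
      (𝓝 (inverseGaussianDensity (kacSigma (ν * σ) σ) δ₀ y t)) := by
  have hu := tendsto_upTime_scaled (y := y) (t := t) hr hp hm hσ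
  have hd := tendsto_downTime_scaled (y := y) (t := t) hr hp hm hσ
  have hev : ∀ᶠ n in l, 0 < r n ∧ 0 < a n ∧ 0 < p n ∧ 0 < m n ∧ y < p n * r n * t := by
    filter_upwards [hr.eventually_gt_atTop 0, ha.eventually_const_lt (by positivity : 0 < ν ^ 2),
      hp.eventually_const_lt (by positivity : 0 < ν ^ 2 * σ), hm.eventually_const_lt hσ,
      eventually_lt_mul (y := y) hr hp hν hσ ht] with n h1 h2 h3 h4 h5
    exact ⟨h1, h2, h3, h4, h5⟩
  set w : ℝ := ν ^ 2 * t / (1 + ν ^ 2) with hw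
  have hwpos : 0 < w := by positivity
  have hau : Tendsto (fun n => a n * upTime (p n * r n) (m n * r n) y t) l (𝓝 w) := by
    rw [hw, mul_div_assoc]; exact ha.mul hu
  have haud : Tendsto (fun n => a n * upTime (p n * r n) (m n * r n) y t *
      downTime (p n * r n) (m n * r n) y t) l (𝓝 (w * w)) := hau.mul hd
  have hz : Tendsto (fun n => besselArg (a n * r n ^ 2) (r n ^ 2) (p n * r n) (m n * r n) y t) l
      atTop := by
    simp only [besselArg_scaled]
    exact ((tendsto_pow_atTop (by norm_num : (4 : ℕ) ≠ 0)).comp hr).atTop_mul_pos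
      (by positivity) haud
  -- Since `z = r ^ 4 * (a u d)`, the factor `z ^ (3 / 4)` supplies exactly the `r ^ 3` of the
  -- density, and `(a u d) ^ (3 / 4)` tends to `w ^ (3 / 2)`.
  have hG := tendsto_rpow_mul_exp_neg_mul_besselSum.comp hz
  have hT : Tendsto (fun n => a n / ((p n + m n) * (a n * upTime (p n * r n) (m n * r n) y t *
      downTime (p n * r n) (m n * r n) y t) ^ (3 / 4 : ℝ))) l
      (𝓝 (ν ^ 2 / ((ν ^ 2 * σ + σ) * (w * w) ^ (3 / 4 : ℝ)))) :=
    ha.div ((hp.add hm).mul (haud.rpow_const (Or.inl (by positivity)))) (by positivity)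
  have hQ : Tendsto (fun n => exp (-((a n + 1) * (y - δ n * t) / ((p n + m n) *
      (√(a n * upTime (p n * r n) (m n * r n) y t) +
        √(downTime (p n * r n) (m n * r n) y t)))) ^ 2)) l
      (𝓝 (exp (-((ν ^ 2 + 1) * (y - δ₀ * t) / ((ν ^ 2 * σ + σ) * (√w + √w))) ^ 2))) := by
    refine (continuous_exp.tendsto _).comp (Tendsto.neg (Tendsto.pow (Tendsto.div ?_ ?_ ?_) 2))
    · exact (ha.add_const 1).mul (tendsto_const_nhds.sub (hδ.mul_const t))
    · exact (hp.add hm).mul (((continuous_sqrt.tendsto _).comp hau).add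
        ((continuous_sqrt.tendsto _).comp hd))
    · positivity
  have hlim := ((hT.const_mul y).mul hG).mul hQ
  have e : y * (ν ^ 2 / ((ν ^ 2 * σ + σ) * (w * w) ^ (3 / 4 : ℝ))) * (1 / (2 * √π)) *
      exp (-((ν ^ 2 + 1) * (y - δ₀ * t) / ((ν ^ 2 * σ + σ) * (√w + √w))) ^ 2) =
      inverseGaussianDensity (kacSigma (ν * σ) σ) δ₀ y t := by
    have hk : kacSigma (ν * σ) σ ^ 2 = 2 * ν ^ 2 * σ ^ 2 / (1 + ν ^ 2) := by
      rw [kacSigma, div_pow, sq_sqrt (by positivity)]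
      field_simp
      ring
    have hkpos : 0 < kacSigma (ν * σ) σ := by unfold kacSigma; positivity
    have hsw : √w ^ 2 = w := sq_sqrt hwpos.le
    unfold inverseGaussianDensity
    congr 1
    · have hww : (w * w) ^ (3 / 4 : ℝ) = w ^ (3 / 2 : ℝ) := by
        rw [← sq, ← rpow_natCast w 2, ← rpow_mul hwpos.le]; norm_num
      have hw3 : w ^ (3 / 2 : ℝ) = ν ^ 3 * t ^ (3 / 2 : ℝ) / (1 + ν ^ 2) ^ (3 / 2 : ℝ) := by
        rw [hw, div_rpow (by positivity) (by positivity), mul_rpow (by positivity) ht.le,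
          ← rpow_natCast ν 2, ← rpow_mul hν.le, ← rpow_natCast ν 3]
        norm_num
      have hB : (1 + ν ^ 2) ^ (3 / 2 : ℝ) = (1 + ν ^ 2) * √(1 + ν ^ 2) := by
        rw [sqrt_eq_rpow, show (3 / 2 : ℝ) = 1 + 1 / 2 by norm_num, rpow_add (by positivity),
          rpow_one]
      have hkac : kacSigma (ν * σ) σ = √2 * ν * σ / √(1 + ν ^ 2) := by
        rw [← pow_left_inj₀ hkpos.le (by positivity) two_ne_zero, hk, div_pow,
          sq_sqrt (by positivity), mul_pow, mul_pow, sq_sqrt zero_le_two]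
      rw [hww, hw3, hB, hkac, sqrt_mul zero_le_two]
      have h2 : √2 ^ 2 = 2 := sq_sqrt zero_le_two
      have h4 : √2 ≠ 0 := by positivity
      have h5 : √π ≠ 0 := by positivity
      have h6 : √(1 + ν ^ 2) ≠ 0 := by positivity
      have h7 : t ^ (3 / 2 : ℝ) ≠ 0 := by positivity
      field_simp
      rw [h2]
      ring
    · congr 1
      rw [hk, div_pow, mul_pow, mul_pow, show (√w + √w) ^ 2 = 4 * √w ^ 2 by ring, hsw, hw]
      field_simp
      ring
  rw [← e]
  refine hlim.congr' ?_
  filter_upwards [hev] with n ⟨h1, h2, h3, h4, h5⟩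
  have hu' := upTime_pos (by positivity : 0 < p n * r n) (by positivity : 0 < m n * r n) hy h5
  have hd' := downTime_pos (by positivity : 0 < p n * r n) (by positivity : 0 < m n * r n) h5
  rw [passageDensity_scaled h1 h2 h3 h4 hy (hrel n) h5]
  simp only [Function.comp]
  congr 1
  rw [mul_assoc y, mul_assoc y]
  congr 1
  rw [← mul_assoc]
  congr 1
  rw [besselArg_scaled, rpow_pow_four_mul h1.le (by positivity)]
  have : (a n * upTime (p n * r n) (m n * r n) y t *
    downTime (p n * r n) (m n * r n) y t) ^ (3 / 4 : ℝ) ≠ 0 := by positivity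
  field_simp

end Limits

/-! ### Uniform integrable bounds -/

section Domination

open Real

theorem exists_rpow_mul_exp_le {κ : ℝ} (hκ : 0 < κ) : ∃ D : ℝ, 0 < D ∧ ∀ t : ℝ, 0 < t →
    (t ^ (-(3 / 2) : ℝ) + t⁻¹ ^ 3) * exp (-(κ / t)) ≤ D * (t + 1) ^ (-(3 / 2) : ℝ) := by
  refine ⟨2 * (exp κ * (6 / κ ^ 3)), by positivity, fun t ht => ?_⟩
  -- Both powers of `1 / t` are at most `(t + 1) ^ (-3/2) * X ^ 3`, and `κ / t = κ * X - κ` lets the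
  -- exponential absorb `X ^ 3` through the cubic term `(κ X)³ / 3!` of its series.
  set X : ℝ := (t + 1) / t with hX
  have hX1 : 1 ≤ X := by rw [hX, le_div_iff₀ ht]; linarith
  have hX0 : 0 < X := by positivity
  set T : ℝ := (t + 1) ^ (-(3 / 2) : ℝ) with hT
  have hTpos : 0 < T := by positivity
  have hT1 : T ≤ 1 := rpow_le_one_of_one_le_of_nonpos (by linarith) (by norm_num)
  have h1 : t ^ (-(3 / 2) : ℝ) = T * X ^ (3 / 2 : ℝ) := by
    rw [hT, hX, div_rpow (by positivity) ht.le, rpow_neg ht.le, rpow_neg (by positivity)]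
    field_simp
  have h2 : t⁻¹ ^ 3 = t ^ (-(3 / 2) : ℝ) * t ^ (-(3 / 2) : ℝ) := by
    rw [← rpow_add ht, inv_pow, ← rpow_natCast t 3, ← rpow_neg ht.le]
    norm_num
  have h3 : X ^ (3 / 2 : ℝ) ≤ X ^ 3 := by
    rw [← rpow_natCast X 3]
    exact rpow_le_rpow_of_exponent_le hX1 (by norm_num)
  have h4 : X ^ (3 / 2 : ℝ) * X ^ (3 / 2 : ℝ) = X ^ 3 := by
    rw [← rpow_add hX0, ← rpow_natCast X 3]; norm_num
  have h5 : t ^ (-(3 / 2) : ℝ) + t⁻¹ ^ 3 ≤ 2 * T * X ^ 3 := by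
    rw [h2, h1]
    have h6 : 0 < X ^ (3 / 2 : ℝ) := by positivity
    have : T * X ^ (3 / 2 : ℝ) * (T * X ^ (3 / 2 : ℝ)) ≤ T * X ^ 3 := by
      rw [← h4]
      calc _ = T * (T * (X ^ (3 / 2 : ℝ) * X ^ (3 / 2 : ℝ))) := by ring
        _ ≤ T * (1 * (X ^ (3 / 2 : ℝ) * X ^ (3 / 2 : ℝ))) := by gcongr
        _ = _ := by ring
    nlinarith [mul_le_mul_of_nonneg_left h3 hTpos.le]
  have h6 : X ^ 3 * exp (-(κ / t)) ≤ exp κ * (6 / κ ^ 3) := by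
    have h7 := pow_div_factorial_le_exp (κ * X) (by positivity) 3
    have h8 : exp (-(κ / t)) = exp κ * (exp (κ * X))⁻¹ := by
      rw [← exp_neg, ← exp_add]
      congr 1
      rw [hX]; field_simp; ring
    have h9 : X ^ 3 ≤ 6 / κ ^ 3 * exp (κ * X) := by
      rw [mul_pow] at h7
      norm_num [Nat.factorial] at h7
      rw [div_mul_eq_mul_div, le_div_iff₀ (by positivity)]
      linarith
    rw [h8]
    calc X ^ 3 * (exp κ * (exp (κ * X))⁻¹)
        ≤ (6 / κ ^ 3 * exp (κ * X)) * (exp κ * (exp (κ * X))⁻¹) := by gcongr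
      _ = _ := by field_simp
  calc _ ≤ 2 * T * X ^ 3 * exp (-(κ / t)) := by gcongr
    _ = 2 * T * (X ^ 3 * exp (-(κ / t))) := by ring
    _ ≤ 2 * T * (exp κ * (6 / κ ^ 3)) := by gcongr
    _ = _ := by ring

variable {r a p m y t δ a₀ A p₀ m₀ B K : ℝ}

theorem upTime_scaled_le (hr : 0 < r) (hp : 0 < p) (hm : 0 < m) (ht : y < p * r * t) :
    upTime (p * r) (m * r) y t ≤ t := by
  rw [upTime_scaled hr, div_le_iff₀ (by positivity)]
  have : y / r < p * t := by rw [div_lt_iff₀ hr]; linarith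
  linarith

theorem downTime_scaled_le (hr : 0 < r) (hp : 0 < p) (hm : 0 < m) (hy : 0 < y)
    (ht : y < p * r * t) : downTime (p * r) (m * r) y t ≤ t := by
  have ht0 : 0 < t := pos_of_mul_pos_right (hy.trans ht) (by positivity)
  rw [downTime_scaled hr, div_le_iff₀ (by positivity)]
  have : 0 < y / r := by positivity
  have : 0 < m * t := by positivity
  linarith

theorem le_upTime_scaled (hr : 0 < r) (hp : 0 < p) (hpB : p ≤ B) (hm₀ : 0 < m₀) (hm : m₀ ≤ m)
    (hmB : m ≤ B) (hy : 0 < y) (ht : 0 < t) :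
    m₀ / (2 * B) * t ≤ upTime (p * r) (m * r) y t := by
  rw [upTime_scaled hr, div_mul_eq_mul_div]
  have : 0 < y / r := by positivity
  have : 0 < m := hm₀.trans_le hm
  apply div_le_div₀ (by positivity) _ (by positivity) (by linarith)
  nlinarith

theorem exists_passageRatio_scaled_le (ha₀ : 0 < a₀) (hm₀ : 0 < m₀) (hB : 0 < B) (hy : 0 < y) :
    ∃ D : ℝ, 0 < D ∧ ∀ r a p m t : ℝ, 1 ≤ r → a₀ ≤ a → 0 < p → p ≤ B → m₀ ≤ m → m ≤ B →
      y < p * r * t → passageRatio (a * r ^ 2) (r ^ 2) (p * r) (m * r) y t ≤ D := by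
  refine ⟨B / (a₀ * 1 * y) + √(2 * B / (m₀ * a₀)), by positivity, ?_⟩
  intro r a p m t hr ha hp hpB hm hmB ht
  have hr0 : 0 < r := by linarith
  have ha0 : 0 < a := by linarith
  have hm0 : 0 < m := by linarith
  have ht0 : 0 < t := pos_of_mul_pos_right (hy.trans ht) (by positivity)
  refine (passageRatio_scaled_le hr0 ha0 hp hm0 hy ht).trans (add_le_add (by gcongr) ?_)
  have hu := upTime_pos (by positivity : 0 < p * r) (by positivity : 0 < m * r) hy ht
  have hd := downTime_pos (by positivity : 0 < p * r) (by positivity : 0 < m * r) ht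
  have h1 := le_upTime_scaled (y := y) hr0 hp hpB hm₀ hm hmB hy ht0
  have h2 := downTime_scaled_le hr0 hp hm0 hy ht
  set u := upTime (p * r) (m * r) y t
  set d := downTime (p * r) (m * r) y t
  rw [div_le_iff₀ (by positivity)]
  refine sqrt_le_iff.2 ⟨by positivity, ?_⟩
  rw [mul_pow, sq_sqrt (by positivity)]
  have h3 : d ≤ 2 * B / m₀ * u := by
    refine h2.trans ?_
    rw [div_mul_eq_mul_div, div_le_iff₀ (by positivity)] at h1
    rw [div_mul_eq_mul_div, le_div_iff₀ hm₀]
    linarith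
  calc a * u * d ≤ a * u * (2 * B / m₀ * u) := by gcongr
    _ = 2 * B / (m₀ * a₀) * (a * (a₀ * u ^ 2)) := by field_simp
    _ ≤ 2 * B / (m₀ * a₀) * (a * (a * u ^ 2)) := by gcongr
    _ = _ := by ring

/-- The squared denominator is at most `8 B² (a + 1) t`, whence the constant `1 / (8 B²)`. Then `(y
- δ t)² / t ≥ y² / t - 2 y δ` needs only an upper bound on the drift. -/
theorem exp_neg_sq_scaled_le (hr : 0 < r) (ha : 0 < a) (hp : 0 < p) (hpB : p ≤ B) (hm : 0 < m)
    (hmB : m ≤ B) (hy : 0 < y) (hδK : δ ≤ K) (ht : y < p * r * t) :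
    exp (-((a + 1) * (y - δ * t) / ((p + m) * (√(a * upTime (p * r) (m * r) y t) +
        √(downTime (p * r) (m * r) y t)))) ^ 2) ≤
      exp (2 * (1 / (8 * B ^ 2)) * y * K) * exp (-(1 / (8 * B ^ 2) * y ^ 2 / t)) := by
  have hB : 0 < B := hp.trans_le hpB
  have ht0 : 0 < t := pos_of_mul_pos_right (hy.trans ht) (by positivity)
  have hu := upTime_pos (by positivity : 0 < p * r) (by positivity : 0 < m * r) hy ht
  have hd := downTime_pos (by positivity : 0 < p * r) (by positivity : 0 < m * r) ht
  have hut := upTime_scaled_le hr hp hm ht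
  have hdt := downTime_scaled_le hr hp hm hy ht
  rw [← exp_add, exp_le_exp, div_pow, mul_pow, mul_pow]
  set u := upTime (p * r) (m * r) y t
  set d := downTime (p * r) (m * r) y t
  have hs1 : 0 < √(a * u) := sqrt_pos.2 (by positivity)
  have hs2 : 0 < √d := sqrt_pos.2 hd
  have hsum : (√(a * u) + √d) ^ 2 ≤ 2 * ((a + 1) * t) := by
    have e1 : √(a * u) ^ 2 = a * u := sq_sqrt (by positivity)
    have e2 : √d ^ 2 = d := sq_sqrt hd.le
    have e3 : a * u ≤ a * t := by gcongr
    nlinarith [sq_nonneg (√(a * u) - √d)]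
  have hpm : (p + m) ^ 2 ≤ (2 * B) ^ 2 := by gcongr; linarith
  have hden : (p + m) ^ 2 * (√(a * u) + √d) ^ 2 ≤ (2 * B) ^ 2 * (2 * ((a + 1) * t)) := by gcongr
  have h1 : 1 / (8 * B ^ 2) * (y - δ * t) ^ 2 / t ≤
      (a + 1) ^ 2 * (y - δ * t) ^ 2 / ((p + m) ^ 2 * (√(a * u) + √d) ^ 2) := by
    refine le_trans ?_ (div_le_div_of_nonneg_left (by positivity) (by positivity) hden)
    rw [div_le_div_iff₀ ht0 (by positivity)]
    have : 1 / (8 * B ^ 2) * (y - δ * t) ^ 2 * ((2 * B) ^ 2 * (2 * ((a + 1) * t))) =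
      (a + 1) * (y - δ * t) ^ 2 * t := by field_simp; ring
    rw [this]
    gcongr
    nlinarith
  have h2 : 1 / (8 * B ^ 2) * y ^ 2 / t - 2 * (1 / (8 * B ^ 2)) * y * K ≤
      1 / (8 * B ^ 2) * (y - δ * t) ^ 2 / t := by
    rw [le_div_iff₀ ht0, sub_mul, div_mul_cancel₀ _ ht0.ne']
    have hκ : 0 < 1 / (8 * B ^ 2) := by positivity
    generalize 1 / (8 * B ^ 2) = κ at hκ
    have h3 : κ * y * t * δ ≤ κ * y * t * K := by gcongr
    nlinarith [mul_nonneg hκ.le (sq_nonneg (δ * t))]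
  linarith

theorem exists_besselSum_scaled_le (ha₀ : 0 < a₀) (hp₀ : 0 < p₀) (hm₀ : 0 < m₀) (hB : 0 < B)
    (hy : 0 < y) :
    ∃ C : ℝ, 0 < C ∧ ∀ r a p m t : ℝ, 0 < r → a₀ ≤ a → p₀ ≤ p → p ≤ B → m₀ ≤ m → m ≤ B →
      y < p * r * t →
      r ^ 3 * (exp (-(2 * √(besselArg (a * r ^ 2) (r ^ 2) (p * r) (m * r) y t))) *
        besselSum (besselArg (a * r ^ 2) (r ^ 2) (p * r) (m * r) y t)) ≤
      C * (t ^ (-(3 / 2) : ℝ) + t⁻¹ ^ 3) := by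
  obtain ⟨C, hC, hCb⟩ := exists_besselSum_bound
  have hβ0 : 0 < a₀ * (m₀ / (2 * B)) * (p₀ / (4 * B)) := by positivity
  set β : ℝ := a₀ * (m₀ / (2 * B)) * (p₀ / (4 * B)) with hβ
  refine ⟨C * ((β ^ (3 / 4 : ℝ))⁻¹ + (2 * y / p₀) ^ 3), by positivity, ?_⟩
  intro r a p m t hr ha hp hpB hm hmB ht
  have ha0 : 0 < a := by linarith
  have hm0 : 0 < m := by linarith
  have hp0 : 0 < p := by linarith
  have ht0 : 0 < t := pos_of_mul_pos_right (hy.trans ht) (by positivity)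
  have hz := besselArg_pos (by positivity : 0 < a * r ^ 2) (by positivity : 0 < r ^ 2)
    (by positivity : 0 < p * r) (by positivity : 0 < m * r) hy ht
  have hu := upTime_pos (by positivity : 0 < p * r) (by positivity : 0 < m * r) hy ht
  have htu := le_upTime_scaled (y := y) hr hp0 hpB hm₀ hm hmB hy ht0
  obtain ⟨hG1, hG2⟩ := hCb _ hz.le
  have hh := besselSum_pos hz.le
  have hG0 : 0 < exp (-(2 * √(besselArg (a * r ^ 2) (r ^ 2) (p * r) (m * r) y t))) *
    besselSum (besselArg (a * r ^ 2) (r ^ 2) (p * r) (m * r) y t) := by positivity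
  have hmono : ∀ {G x w : ℝ}, G ≤ C * x → x ≤ w → G ≤ C * w := fun h1 h2 =>
    h1.trans (mul_le_mul_of_nonneg_left h2 hC.le)
  have h32 : 0 < t ^ (-(3 / 2) : ℝ) := by positivity
  have hβ34 : 0 < (β ^ (3 / 4 : ℝ))⁻¹ := by positivity
  have h5 : 0 < (2 * y / p₀) ^ 3 := by positivity
  have h6 : 0 < t⁻¹ ^ 3 := by positivity
  rw [mul_assoc C]
  -- Away from the edge of the support the down time is of order `t`, and the weighted Bessel bound
  -- gives `t ^ (-3/2)`. Near the edge `r` itself is at most of order `1 / t`, so the plain bound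
  -- gives `t⁻¹ ^ 3`.
  rcases le_or_gt (2 * y) (p * r * t) with hcase | hcase
  · have htd : p₀ / (4 * B) * t ≤ downTime (p * r) (m * r) y t := by
      rw [downTime_scaled hr, le_div_iff₀ (by positivity)]
      have h1 : y / r ≤ p * t / 2 := by rw [div_le_iff₀ hr]; linarith
      have h2 : p₀ / (4 * B) * t * (p + m) ≤ p₀ / (4 * B) * t * (B + B) := by gcongr
      have h3 : p₀ / (4 * B) * t * (B + B) = p₀ * t / 2 := by field_simp; ring
      have h4 : p₀ * t ≤ p * t := by gcongr
      linarith
    have hzz : r ^ 4 * (β * t ^ 2) ≤ besselArg (a * r ^ 2) (r ^ 2) (p * r) (m * r) y t := by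
      rw [besselArg_scaled]
      calc r ^ 4 * (β * t ^ 2) =
          r ^ 4 * (a₀ * (m₀ / (2 * B) * t) * (p₀ / (4 * B) * t)) := by rw [hβ]; ring
        _ ≤ _ := by gcongr
    have h1 : r ^ 3 * (β ^ (3 / 4 : ℝ) * t ^ (3 / 2 : ℝ)) ≤
        besselArg (a * r ^ 2) (r ^ 2) (p * r) (m * r) y t ^ (3 / 4 : ℝ) := by
      refine le_trans (le_of_eq ?_) (rpow_le_rpow (by positivity) hzz (by norm_num))
      rw [rpow_pow_four_mul hr.le (by positivity), mul_rpow hβ0.le (by positivity),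
        ← rpow_natCast t 2, ← rpow_mul ht0.le]
      norm_num
    have h2 := (mul_le_mul_of_nonneg_right h1 hG0.le).trans hG2
    refine hmono (x := (β ^ (3 / 4 : ℝ))⁻¹ * t ^ (-(3 / 2) : ℝ)) ?_ ?_
    · rw [rpow_neg ht0.le, ← mul_inv, ← div_eq_mul_inv, le_div_iff₀ (by positivity)]
      linarith
    · apply mul_le_mul <;> linarith
  · have h1 : r ≤ 2 * y / p₀ * t⁻¹ := by
      rw [← div_eq_mul_inv, div_div, le_div_iff₀ (by positivity)]
      have : r * (p₀ * t) ≤ r * (p * t) := by gcongr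
      linarith
    refine hmono (x := (2 * y / p₀) ^ 3 * t⁻¹ ^ 3) ?_ ?_
    · rw [← mul_pow, mul_comm C]
      exact mul_le_mul (pow_le_pow_left₀ hr.le h1 3) hG1 hG0.le (by positivity)
    · apply mul_le_mul <;> linarith

theorem exists_passageDensity_scaled_le (ha₀ : 0 < a₀) (hp₀ : 0 < p₀) (hm₀ : 0 < m₀) (hA : 0 < A)
    (hB : 0 < B) (hy : 0 < y) (K : ℝ) :
    ∃ D : ℝ, 0 < D ∧ ∀ r a p m δ t : ℝ, 0 < r → a₀ ≤ a → a ≤ A → p₀ ≤ p → p ≤ B → m₀ ≤ m →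
      m ≤ B → δ ≤ K → r * (p - m * a) = δ * (a + 1) → 0 < t →
      passageDensity (a * r ^ 2) (r ^ 2) (p * r) (m * r) y t ≤ D * (t + 1) ^ (-(3 / 2) : ℝ) := by
  obtain ⟨C₁, hC₁, hG⟩ := exists_besselSum_scaled_le ha₀ hp₀ hm₀ hB hy
  obtain ⟨D, hD, hDb⟩ := exists_rpow_mul_exp_le (κ := 1 / (8 * B ^ 2) * y ^ 2) (by positivity)
  refine ⟨y * (A / p₀) * C₁ * exp (2 * (1 / (8 * B ^ 2)) * y * K) * D, by positivity, ?_⟩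
  intro r a p m δ t hr ha haA hp hpB hm hmB hδK hrel ht0
  by_cases ht : y < p * r * t
  swap
  · rw [passageDensity, if_neg ht]; positivity
  have ha0 : 0 < a := by linarith
  have hm0 : 0 < m := by linarith
  have hp0 : 0 < p := by linarith
  rw [passageDensity_scaled hr ha0 hp0 hm0 hy hrel ht]
  have hz := besselArg_pos (by positivity : 0 < a * r ^ 2) (by positivity : 0 < r ^ 2)
    (by positivity : 0 < p * r) (by positivity : 0 < m * r) hy ht
  have hh := besselSum_pos hz.le
  have hGr := hG r a p m t hr ha hp hpB hm hmB ht
  have hQ := exp_neg_sq_scaled_le hr ha0 hp0 hpB hm0 hmB hy hδK ht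
  have hfac : a * r ^ 3 / (p + m) ≤ A / p₀ * r ^ 3 := by
    rw [div_mul_eq_mul_div]
    exact div_le_div₀ (by positivity) (by gcongr) hp₀ (by linarith)
  have hG0 : 0 ≤ exp (-(2 * √(besselArg (a * r ^ 2) (r ^ 2) (p * r) (m * r) y t))) *
    besselSum (besselArg (a * r ^ 2) (r ^ 2) (p * r) (m * r) y t) := by positivity
  generalize exp (-(2 * √(besselArg (a * r ^ 2) (r ^ 2) (p * r) (m * r) y t))) *
    besselSum (besselArg (a * r ^ 2) (r ^ 2) (p * r) (m * r) y t) = G at hGr hG0 ⊢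
  have hDt := hDb t ht0
  have h1 : y * (a * r ^ 3 / (p + m)) * G ≤
      y * (A / p₀) * (C₁ * (t ^ (-(3 / 2) : ℝ) + t⁻¹ ^ 3)) := by
    calc y * (a * r ^ 3 / (p + m)) * G ≤ y * (A / p₀ * r ^ 3) * G := by gcongr
      _ = y * (A / p₀) * (r ^ 3 * G) := by ring
      _ ≤ _ := by gcongr
  refine (mul_le_mul h1 hQ (exp_pos _).le (by positivity)).trans ?_
  have hE₁ := (exp_pos (2 * (1 / (8 * B ^ 2)) * y * K)).le
  generalize exp (2 * (1 / (8 * B ^ 2)) * y * K) = E₁ at *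
  have h2 := mul_le_mul_of_nonneg_left hDt (by positivity : 0 ≤ y * (A / p₀) * C₁)
  have h3 := mul_le_mul_of_nonneg_left h2 hE₁
  linarith

end Domination

/-! ### Passage to the limit and Kac's scaling -/

/-- Convergence of measures with an atom of vanishing mass and with convergent, dominated
densities. -/
theorem tendsto_of_hasAtomAndDensity {ι : Type*} {l : Filter ι} [l.IsCountablyGenerated]
    {μ : ι → Measure ℝ} [∀ n, IsFiniteMeasure (μ n)] {A b : ι → ℝ} {f : ι → ℝ → ℝ} {q : ℝ → ℝ}
    (h : ∀ᶠ n in l, HasAtomAndDensity (μ n) (A n) (b n) (f n)) (hb : ∀ᶠ n in l, 0 ≤ b n)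
    (hb₀ : Tendsto b l (𝓝 0)) (hA : Tendsto A l (𝓝 0))
    (hf : ∀ᶠ n in l, ∀ t, b n < t → ContinuousAt (f n) t)
    (hq : ∀ t, 0 < t → Tendsto (fun n => f n t) l (𝓝 (q t)))
    {D : ℝ} (hD : ∀ᶠ n in l, ∀ t, 0 < t → f n t ≤ D * (t + 1) ^ (-(3 / 2) : ℝ)) :
    (∀ g : BoundedContinuousFunction ℝ ℝ, Tendsto (fun n => ∫ t, g t ∂(μ n)) l
        (𝓝 (∫ t in Set.Ioi (0 : ℝ), g t * q t))) ∧
    (∀ t : ℝ, 0 < t →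
      (∀ᶠ n in l, DifferentiableAt ℝ (fun s => (μ n).real (Set.Iic s)) t) ∧
      Tendsto (fun n => deriv (fun s => (μ n).real (Set.Iic s)) t) l (𝓝 (q t))) := by
  refine ⟨fun g => ?_, fun t ht => ?_⟩
  · have h1 : Tendsto (fun n => A n * g (b n)) l (𝓝 0) := by
      refine squeeze_zero_norm (a := fun n => ‖A n‖ * ‖g‖) (fun n => ?_)
        (by simpa using hA.norm.mul_const ‖g‖)
      rw [norm_mul]
      gcongr
      exact g.norm_coe_le_norm _
    have h2 : Tendsto (fun n => ∫ t in Set.Ioi (0 : ℝ), g t * f n t) l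
        (𝓝 (∫ t in Set.Ioi (0 : ℝ), g t * q t)) := by
      refine tendsto_integral_filter_of_dominated_convergence
        (fun t => ‖g‖ * (D * (t + 1) ^ (-(3 / 2) : ℝ))) ?_ ?_ ?_ ?_
      · filter_upwards [h] with n hn
        exact g.continuous.aestronglyMeasurable.mul hn.measurable.aestronglyMeasurable
      · filter_upwards [h, hD] with n hn hDn
        filter_upwards [ae_restrict_mem measurableSet_Ioi] with t ht
        rw [norm_mul, Real.norm_of_nonneg (hn.nonneg t)]
        exact mul_le_mul (g.norm_coe_le_norm t) (hDn t ht) (hn.nonneg t) (norm_nonneg g)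
      -- The exponent `-3/2` is below `-1`, and the shift by `1` removes the singularity at `0`.
      · exact ((integrableOn_add_rpow_Ioi_of_lt (a := -(3 / 2)) (c := 0) (m := 1) (by norm_num)
          (by norm_num)).const_mul D).const_mul ‖g‖
      · filter_upwards [ae_restrict_mem measurableSet_Ioi] with t ht
        exact (hq t ht).const_mul _
    have h3 := h1.add h2
    rw [zero_add] at h3
    refine h3.congr' ?_
    filter_upwards [h, hb] with n hn hbn
    exact (hn.integral_eq hbn g).symm
  · have hd : ∀ᶠ n in l, HasDerivAt (fun s => (μ n).real (Set.Iic s)) (f n t) t := by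
      filter_upwards [h, hf, hb₀.eventually_lt_const ht] with n hn hfn hbn
      exact hn.hasDerivAt hbn (hfn t hbn)
    refine ⟨hd.mono fun n hn => hn.differentiableAt, (hq t ht).congr' ?_⟩
    filter_upwards [hd] with n hn
    exact hn.deriv.symm

/-- Kac's scaling, in terms of `r = √λ₁`, `a = λ₀ / λ₁`, `p = γ₀ / √λ₁`, `m = -γ₁ / √λ₁` and of the
mean velocity `δ`. -/
structure IsKacScaling {ι : Type*} (l : Filter ι) (r a p m δ : ι → ℝ) (ν σ δ₀ : ℝ) : Prop where
  nu_pos : 0 < ν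
  sigma_pos : 0 < σ
  tendsto_r : Tendsto r l atTop
  tendsto_a : Tendsto a l (𝓝 (ν ^ 2))
  tendsto_p : Tendsto p l (𝓝 (ν ^ 2 * σ))
  tendsto_m : Tendsto m l (𝓝 σ)
  tendsto_drift : Tendsto δ l (𝓝 δ₀)
  drift_eq : ∀ n, r n * (p n - m n * a n) = δ n * (a n + 1)

section KacScaling

variable {ι : Type*} {l : Filter ι} {r a p m δ : ι → ℝ} {ν σ δ₀ y : ℝ}

theorem IsKacScaling.eventually_bounds (h : IsKacScaling l r a p m δ ν σ δ₀) :
    ∀ᶠ n in l, 1 ≤ r n ∧ (ν ^ 2 / 2 ≤ a n ∧ a n ≤ ν ^ 2 + 1) ∧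
      (ν ^ 2 * σ / 2 ≤ p n ∧ p n ≤ ν ^ 2 * σ + σ + 1) ∧
      (σ / 2 ≤ m n ∧ m n ≤ ν ^ 2 * σ + σ + 1) ∧ δ n ≤ δ₀ + 1 := by
  have hν := h.nu_pos
  have hσ := h.sigma_pos
  have h1 : 0 < ν ^ 2 := by positivity
  have h2 : 0 < ν ^ 2 * σ := by positivity
  filter_upwards [h.tendsto_r.eventually_ge_atTop 1,
    h.tendsto_a.eventually_const_le (half_lt_self h1), h.tendsto_a.eventually_le_const (lt_add_one _),
    h.tendsto_p.eventually_const_le (half_lt_self h2),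
    h.tendsto_p.eventually_le_const (by linarith : ν ^ 2 * σ < ν ^ 2 * σ + σ + 1),
    h.tendsto_m.eventually_const_le (half_lt_self hσ),
    h.tendsto_m.eventually_le_const (by linarith : σ < ν ^ 2 * σ + σ + 1),
    h.tendsto_drift.eventually_le_const (lt_add_one _)] with n h1 h2 h3 h4 h5 h6 h7 h8
  exact ⟨h1, ⟨h2, h3⟩, ⟨h4, h5⟩, ⟨h6, h7⟩, h8⟩

theorem IsKacScaling.exists_density_bound (h : IsKacScaling l r a p m δ ν σ δ₀) (hy : 0 < y) :
    ∃ D : ℝ, 0 < D ∧ ∀ᶠ n in l, ∀ t, 0 < t →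
      passageDensity (a n * r n ^ 2) (r n ^ 2) (p n * r n) (m n * r n) y t ≤
        D * (t + 1) ^ (-(3 / 2) : ℝ) := by
  have hν := h.nu_pos
  have hσ := h.sigma_pos
  obtain ⟨D, hD0, hD⟩ := exists_passageDensity_scaled_le (a₀ := ν ^ 2 / 2) (A := ν ^ 2 + 1)
    (p₀ := ν ^ 2 * σ / 2) (m₀ := σ / 2) (B := ν ^ 2 * σ + σ + 1) (y := y) (by positivity)
    (by positivity) (by positivity) (by positivity) (by positivity) hy (δ₀ + 1)
  refine ⟨D, hD0, ?_⟩
  filter_upwards [h.eventually_bounds] with n ⟨h1, h2, h3, h4, h5⟩ t ht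
  exact hD _ _ _ _ _ t (by linarith) h2.1 h2.2 h3.1 h3.2 h4.1 h4.2 h5 (h.drift_eq n) ht

theorem IsKacScaling.exists_ratio_bound (h : IsKacScaling l r a p m δ ν σ δ₀) (hy : 0 < y) :
    ∃ D : ℝ, 0 < D ∧ ∀ᶠ n in l, ∀ t, y < p n * r n * t →
      passageRatio (a n * r n ^ 2) (r n ^ 2) (p n * r n) (m n * r n) y t ≤ D := by
  have hν := h.nu_pos
  have hσ := h.sigma_pos
  obtain ⟨D, hD0, hD⟩ := exists_passageRatio_scaled_le (a₀ := ν ^ 2 / 2)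
    (m₀ := σ / 2) (B := ν ^ 2 * σ + σ + 1) (y := y) (by positivity)
    (by positivity) (by positivity) hy
  refine ⟨D, hD0, ?_⟩
  filter_upwards [h.eventually_bounds] with n ⟨h1, h2, h3, h4, h5⟩ t ht
  have : 0 < ν ^ 2 * σ / 2 := by positivity
  exact hD _ _ _ _ t h1 h2.1 (by linarith) h3.2 h4.1 h4.2 ht

theorem IsKacScaling.exists_mul_bound (h : IsKacScaling l r a p m δ ν σ δ₀) (hy : 0 < y) :
    ∃ D : ℝ, 0 < D ∧ ∀ᶠ n in l, ∀ t, 0 < t →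
      passageDensity (a n * r n ^ 2) (r n ^ 2) (p n * r n) (m n * r n) y t *
        passageRatio (a n * r n ^ 2) (r n ^ 2) (p n * r n) (m n * r n) y t ≤
        D * (t + 1) ^ (-(3 / 2) : ℝ) := by
  have hν := h.nu_pos
  have hσ := h.sigma_pos
  obtain ⟨D₁, hD₁0, hD₁⟩ := h.exists_density_bound hy
  obtain ⟨D₂, hD₂0, hD₂⟩ := h.exists_ratio_bound hy
  refine ⟨D₁ * D₂, by positivity, ?_⟩
  filter_upwards [hD₁, hD₂, h.eventually_bounds] with n hn₁ hn₂ ⟨h1, h2, h3, h4, h5⟩ t ht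
  have ha : 0 < a n := by have : 0 < ν ^ 2 / 2 := by positivity
                          linarith
  have hp : 0 < p n := by have : 0 < ν ^ 2 * σ / 2 := by positivity
                          linarith
  have hm : 0 < m n := by linarith
  have hr : 0 < r n := by linarith
  by_cases hyt : y < p n * r n * t
  · have hle := mul_le_mul (hn₁ t ht) (hn₂ t hyt) (passageRatio_nonneg (by positivity)
      (by positivity) (by positivity) (by positivity) hy hyt) (by positivity)
    linarith
  · rw [passageDensity, if_neg hyt, zero_mul]
    positivity

end KacScaling

theorem isKacScaling_of_tendsto {ι : Type*} {l : Filter ι} [l.NeBot] {lam γ : ι → Fin 2 → ℝ}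
    (hlam : ∀ n j, 0 < lam n j) {ν σ₀ σ₁ δ : ℝ} (hν : 0 < ν) (hσ₁ : 0 < σ₁)
    (hlam₁ : Tendsto (fun n => lam n 1) l atTop)
    (hratio : Tendsto (fun n => lam n 0 / lam n 1) l (𝓝 (ν ^ 2)))
    (hγ₀ : Tendsto (fun n => γ n 0 / √(lam n 0)) l (𝓝 σ₀))
    (hγ₁ : Tendsto (fun n => γ n 1 / √(lam n 1)) l (𝓝 (-σ₁)))
    (hδ : Tendsto (fun n => (γ n 0 * lam n 1 + γ n 1 * lam n 0) / (lam n 0 + lam n 1))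
      l (𝓝 δ)) :
    σ₀ = ν * σ₁ ∧ IsKacScaling l (fun n => √(lam n 1)) (fun n => lam n 0 / lam n 1)
      (fun n => γ n 0 / √(lam n 1)) (fun n => -γ n 1 / √(lam n 1))
      (fun n => (γ n 0 * lam n 1 + γ n 1 * lam n 0) / (lam n 0 + lam n 1)) ν σ₁ δ := by
  have hr : Tendsto (fun n => √(lam n 1)) l atTop := Real.tendsto_sqrt_atTop.comp hlam₁
  have hm : Tendsto (fun n => -γ n 1 / √(lam n 1)) l (𝓝 σ₁) := by
    simpa [neg_div] using hγ₁.neg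
  have hp : Tendsto (fun n => γ n 0 / √(lam n 1)) l (𝓝 (σ₀ * ν)) := by
    have h1 := hγ₀.mul ((Real.continuous_sqrt.tendsto _).comp hratio)
    rw [Real.sqrt_sq hν.le] at h1
    refine h1.congr fun n => ?_
    have h2 := Real.sqrt_pos.2 (hlam n 0)
    simp only [Function.comp]
    rw [Real.sqrt_div (hlam n 0).le]
    field_simp
  have hrel : ∀ n, √(lam n 1) * (γ n 0 / √(lam n 1) - -γ n 1 / √(lam n 1) * (lam n 0 / lam n 1)) =
      (γ n 0 * lam n 1 + γ n 1 * lam n 0) / (lam n 0 + lam n 1) * (lam n 0 / lam n 1 + 1) := by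
    intro n
    have h0 := hlam n 0
    have h1 := hlam n 1
    have h2 := Real.sqrt_pos.2 (hlam n 1)
    field_simp
    ring
  -- The quantity `r * (p - m * a)` stays bounded while `r` tends to infinity, so `p - m * a` tends
  -- to `0`; its limit is also `σ₀ ν - σ₁ ν²`.
  have hσ : σ₀ = ν * σ₁ := by
    have h1 := hp.sub (hm.mul hratio)
    have h2 : Tendsto (fun n => γ n 0 / √(lam n 1) - -γ n 1 / √(lam n 1) * (lam n 0 / lam n 1)) l
        (𝓝 0) := by
      refine ((hδ.mul (hratio.add_const 1)).div_atTop hr).congr fun n => ?_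
      rw [← hrel n, mul_div_cancel_left₀ _ (Real.sqrt_pos.2 (hlam n 1)).ne']
    have h3 := tendsto_nhds_unique h1 h2
    have h4 : ν * (σ₀ - ν * σ₁) = 0 := by linarith
    rcases mul_eq_zero.1 h4 with h | h
    · exact absurd h hν.ne'
    · linarith
  refine ⟨hσ, hν, hσ₁, hr, hratio, ?_, hm, hδ, hrel⟩
  convert hp using 2
  rw [hσ]; ring

/-! ### The limit theorem -/

theorem corollary1 {ι : Type*} (l : Filter ι) [l.IsCountablyGenerated]
    {Ω : ι → Type*} [∀ n, MeasurableSpace (Ω n)]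
    (P : ∀ n, Measure (Ω n)) [∀ n, IsProbabilityMeasure (P n)]
    (lam γ : ι → Fin 2 → ℝ) (i : Fin 2) (ε : ∀ n, ℝ → Ω n → Fin 2)
    (hlam : ∀ n j, 0 < lam n j)
    (hε : ∀ n, IsTwoStateMarkov (lam n) i (P n) (ε n))
    (ν σ₀ σ₁ δ : ℝ) (hν : 0 < ν) (hσ₀ : 0 < σ₀) (hσ₁ : 0 < σ₁)
    (hlam₀ : Tendsto (fun n => lam n 0) l atTop)
    (hlam₁ : Tendsto (fun n => lam n 1) l atTop)
    (hratio : Tendsto (fun n => lam n 0 / lam n 1) l (𝓝 (ν ^ 2)))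
    (hγ₀ : Tendsto (fun n => γ n 0 / √(lam n 0)) l (𝓝 σ₀))
    (hγ₁ : Tendsto (fun n => γ n 1 / √(lam n 1)) l (𝓝 (-σ₁)))
    (hδ : Tendsto (fun n => (γ n 0 * lam n 1 + γ n 1 * lam n 0) / (lam n 0 + lam n 1))
      l (𝓝 δ))
    (y : ℝ) (hy : 0 < y) :
    -- weak convergence of the (possibly defective) distributions, total masses included
    (∀ g : BoundedContinuousFunction ℝ ℝ,
      Tendsto (fun n => ∫ t, g t ∂(firstPassageLaw (γ n) (ε n) (P n) y)) l
        (𝓝 (∫ t in Set.Ioi (0 : ℝ), g t * inverseGaussianDensity (kacSigma σ₀ σ₁) δ y t))) ∧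
    -- pointwise convergence of the densities
    (∀ t : ℝ, 0 < t →
      (∀ᶠ n in l, DifferentiableAt ℝ
        (fun s => (firstPassageLaw (γ n) (ε n) (P n) y).real (Set.Iic s)) t) ∧
      Tendsto
        (fun n => deriv
          (fun s => (firstPassageLaw (γ n) (ε n) (P n) y).real (Set.Iic s)) t) l
        (𝓝 (inverseGaussianDensity (kacSigma σ₀ σ₁) δ y t))) := by
  -- The relation `σ₀ = ν σ₁` uses uniqueness of limits, so the trivial filter is treated apart.
  rcases l.eq_or_neBot with rfl | hl
  · simp
  obtain ⟨rfl, hK⟩ := isKacScaling_of_tendsto hlam hν hσ₁ hlam₁ hratio hγ₀ hγ₁ hδ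
  have hfin : ∀ n, IsFiniteMeasure (firstPassageLaw (γ n) (ε n) (P n) y) := fun n =>
    isFiniteMeasure_firstPassageLaw _ _ _
  have hsq : ∀ n, √(lam n 1) ≠ 0 := fun n => (Real.sqrt_pos.2 (hlam n 1)).ne'
  have e₀ : ∀ n, lam n 0 / lam n 1 * lam n 1 = lam n 0 := fun n =>
    div_mul_cancel₀ _ (hlam n 1).ne'
  have e₁ : ∀ n, √(lam n 1) ^ 2 = lam n 1 := fun n => Real.sq_sqrt (hlam n 1).le
  have e₂ : ∀ n, γ n 0 / √(lam n 1) * √(lam n 1) = γ n 0 := fun n => div_mul_cancel₀ _ (hsq n)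
  have e₃ : ∀ n, -γ n 1 / √(lam n 1) * √(lam n 1) = -γ n 1 := fun n => div_mul_cancel₀ _ (hsq n)
  have hpos : ∀ᶠ n in l, 0 < γ n 0 ∧ γ n 1 < 0 := by
    filter_upwards [hγ₀.eventually_const_lt hσ₀, hγ₁.eventually_lt_const (neg_neg_of_pos hσ₁)]
      with n h0 h1
    exact ⟨(div_pos_iff_of_pos_right (Real.sqrt_pos.2 (hlam n 0))).1 h0,
      by by_contra! hc; exact absurd h1 (not_lt.2 (div_nonneg hc (Real.sqrt_nonneg _)))⟩
  have hb : ∀ᶠ n in l, 0 ≤ y / γ n 0 := hpos.mono fun n hn => (div_pos hy hn.1).le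
  have hγtop : Tendsto (fun n => γ n 0) l atTop := by
    refine (hK.tendsto_p.pos_mul_atTop (by positivity) hK.tendsto_r).congr fun n => ?_
    exact e₂ n
  have hb₀ : Tendsto (fun n => y / γ n 0) l (𝓝 0) := tendsto_const_nhds.div_atTop hγtop
  have hdens : ∀ t, 0 < t → Tendsto
      (fun n => passageDensity (lam n 0) (lam n 1) (γ n 0) (-γ n 1) y t) l
      (𝓝 (inverseGaussianDensity (kacSigma (ν * σ₁) σ₁) δ y t)) := fun t ht => by
    have := tendsto_passageDensity_scaled hK.tendsto_r hK.tendsto_a hK.tendsto_p hK.tendsto_m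
      hν hσ₁ hy hK.tendsto_drift hK.drift_eq ht
    simpa only [e₀, e₁, e₂, e₃] using this
  have hratio' : ∀ t, 0 < t → Tendsto
      (fun n => passageRatio (lam n 0) (lam n 1) (γ n 0) (-γ n 1) y t) l (𝓝 1) := fun t ht => by
    have := tendsto_passageRatio_scaled hK.tendsto_r hK.tendsto_a hK.tendsto_p hK.tendsto_m
      hν hσ₁ hy ht
    simpa only [e₀, e₁, e₂, e₃] using this
  have hlt : ∀ {n t}, 0 < γ n 0 → y / γ n 0 < t → y < γ n 0 * t := fun {n t} h ht => by
    rwa [div_lt_iff₀ h, mul_comm] at ht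
  obtain rfl | rfl : i = 0 ∨ i = 1 := by omega
  · obtain ⟨D, -, hD⟩ := hK.exists_density_bound hy
    simp only [e₀, e₁, e₂, e₃] at hD
    refine tendsto_of_hasAtomAndDensity
      (A := fun n => Real.exp (-(lam n 0 * (y / γ n 0)))) (b := fun n => y / γ n 0)
      (f := fun n => passageDensity (lam n 0) (lam n 1) (γ n 0) (-γ n 1) y)
      ?_ hb hb₀ ?_ ?_ hdens hD
    · exact hpos.mono fun n hn =>
        hasAtomAndDensity_firstPassageLaw_up (hlam n) (hε n) hn.1 hn.2 hy
    -- The atom disappears because its exponent `λ₀ y / γ₀` equals `y √λ₀ / (γ₀ / √λ₀)`, with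
    -- denominator tending to `σ₀ > 0`.
    · refine Real.tendsto_exp_neg_atTop_nhds_zero.comp ?_
      have h1 : Tendsto (fun n => y * (√(lam n 0) / (γ n 0 / √(lam n 0)))) l atTop := by
        refine Tendsto.const_mul_atTop hy ?_
        simp only [div_eq_mul_inv √_]
        exact (Real.tendsto_sqrt_atTop.comp hlam₀).atTop_mul_pos (inv_pos.2 hσ₀)
          (hγ₀.inv₀ hσ₀.ne')
      refine h1.congr' ?_
      filter_upwards [hpos] with n hn
      have h2 := Real.sqrt_pos.2 (hlam n 0)
      have h3 := hn.1
      field_simp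
      rw [Real.sq_sqrt (hlam n 0).le]
    · filter_upwards [hpos] with n hn t ht
      exact continuousAt_passageDensity (hlt hn.1 ht)
  · obtain ⟨D, -, hD⟩ := hK.exists_mul_bound hy
    simp only [e₀, e₁, e₂, e₃] at hD
    refine tendsto_of_hasAtomAndDensity (A := fun _ => 0) (b := fun n => y / γ n 0)
      (f := fun n t => passageDensity (lam n 0) (lam n 1) (γ n 0) (-γ n 1) y t *
        passageRatio (lam n 0) (lam n 1) (γ n 0) (-γ n 1) y t)
      ?_ hb hb₀ tendsto_const_nhds ?_ ?_ hD
    · exact hpos.mono fun n hn =>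
        hasAtomAndDensity_firstPassageLaw_down (hlam n) (hε n) hn.1 hn.2 hy
    · filter_upwards [hpos] with n hn t ht
      exact (continuousAt_passageDensity (hlt hn.1 ht)).mul
        (continuousAt_passageRatio (hlam n 0) (hlam n 1) hn.1 (neg_pos.2 hn.2) hy (hlt hn.1 ht))
    · intro t ht
      simpa using (hdens t ht).mul (hratio' t ht)
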